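/- **Theorem 3.1 (Unconditional stability).** Let $d\in\{2,3\}$, let $\Omega\subset\mathbb R^d$ be a bounded domain that admits triangulations (in particular a polygonal or polyhedral domain), and let $T,\kappa,\beta,\theta,U,\gamma>0$ and $g,\alpha\in\mathbb R$. Write $(\cdot,\cdot)$ and $\|\cdot\|$ for the inner product and the norm of $L^2(\Omega)$, $\mathbf V=H^1_0(\Omega)^d$, $\tilde H=\{r\in H^1(\Omega):\int_\Omega r\,dx=0\}$, $\mathbf i_2$ for the unit vector of the $x_2$-direction, and $$\mathbf A(c,\mathbf u,\mathbf v)=(\nu(c+\alpha)\nabla\mathbf u,\nabla\mathbf v),$$ $$B(\mathbf u,\mathbf v,\mathbf w)=\int_\Omega(\mathbf u\cdot\nabla\mathbf v)\cdot\mathbf w\,dx+\tfrac12\int_\Omega(\nabla\cdot\mathbf u)\,\mathbf v\cdot\mathbf w\,dx,\qquad b(\mathbf u,c,r)=\int_\Omega(\mathbf u\cdot\nabla c)\,r\,dx+\tfrac12\int_\Omega(\nabla\cdot\mathbf u)\,c\,r\,dx .$$ For a conforming triangulation $\mathcal T_h$ of $\Omega$ by $d$-simplices, let $b(\mathcal K)$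 be the span of the bubble function of $\mathcal K\in\mathcal T_h$ (the product of its barycentric coordinates), and let $$\mathbf V_h=\{\mathbf v\in C(\bar\Omega)^d\cap\mathbf V:\ \mathbf v|_{\mathcal K}\in(P_1(\mathcal K)\oplus b(\mathcal K))^d\ \forall\mathcal K\in\mathcal T_h\},$$ $$M_h=\{q\in C(\bar\Omega)\cap H^1(\Omega):\ q|_{\mathcal K}\in P_1(\mathcal K)\ \forall\mathcal K\in\mathcal T_h,\ \textstyle\int_\Omega q\,dx=0\},\qquad \tilde H_h=\{r\in C(\bar\Omega)\cap\tilde H:\ r|_{\mathcal K}\in P_1(\mathcal K)\ \forall\mathcal K\in\mathcal T_h\}.$$ There is a constant $C>0$, depending only on $d,\Omega,T,\kappa,\beta,\theta,U,\gamma,g,\alpha$ (in particular not on the time step or on the triangulation), such that the following holds. Let $\nu:\mathbb R\to\mathbb R$ satisfy Assumption A1, that is, $\kappa\le\nu(x)\le\kappa^{-1}$ and $|\nu(x_1)-\nu(x_2)|\le\beta|x_1-x_2|$ for all $x,x_1,x_2\in\mathbb R$; let $\mathbf f(t)\in L^2(\Omega)^d$ for $t\in[0,T]$; let $\mathcal T_h$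 be a triangulation of $\Omega$; let $N\ge1$ be any integer, $\tau=T/N$ and $\mathbf f^n=\mathbf f(n\tau)$. Let $\mathbf u_h^n\in\mathbf V_h$ and $c_h^n\in\tilde H_h$ $(0\le n\le N)$ and $p_h^n\in M_h$ $(1\le n\le N)$ solve the decoupled Crank–Nicolson Leap–Frog scheme: for $n=1,\dots,N-1$ and all $\mathbf v_h\in\mathbf V_h$, $q_h\in M_h$, $\phi_h\in\tilde H_h$, $$\Big(\tfrac{\mathbf u_h^{n+1}-\mathbf u_h^{n-1}}{2\tau},\mathbf v_h\Big)+\mathbf A\Big(c_h^n,\tfrac{\mathbf u_h^{n+1}+\mathbf u_h^{n-1}}2,\mathbf v_h\Big)+B\Big(\mathbf u_h^n,\tfrac{\mathbf u_h^{n+1}+\mathbf u_h^{n-1}}2,\mathbf v_h\Big)-(p_h^n,\nabla\cdot\mathbf v_h)=-(g(1+\gamma c_h^n)\mathbf i_2,\mathbf v_h)+(\mathbf f^n,\mathbf v_h),$$ $$\Big(\nabla\cdot\tfrac{\mathbf u_h^{n+1}+\mathbf u_h^{n-1}}2,q_h\Big)=0,$$ $$\Big(\tfrac{c_h^{n+1}-c_h^{n-1}}{2\tau},\phi_h\Big)+\theta\Big(\nabla\tfrac{c_h^{n+1}+c_h^{n-1}}2,\nabla\phi_h\Big)+b\Big(\mathbf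 u_h^n,\tfrac{c_h^{n+1}+c_h^{n-1}}2,\phi_h\Big)-U\Big(c_h^n,\tfrac{\partial\phi_h}{\partial x_2}\Big)=U\alpha\Big(1,\tfrac{\partial\phi_h}{\partial x_2}\Big).$$ Then, with no restriction on $\tau$, for every $1\le m\le N-1$, $$\|\mathbf u_h^{m+1}\|^2+\|c_h^{m+1}\|^2+\kappa\tau\sum_{n=1}^{N-1}\|\nabla(\mathbf u_h^{n+1}+\mathbf u_h^{n-1})\|^2+\theta\tau\sum_{n=1}^{N-1}\|\nabla(c_h^{n+1}+c_h^{n-1})\|^2$$ $$\le C\big(\|\mathbf u_h^0\|^2+\|\mathbf u_h^1\|^2+\|c_h^0\|^2+\|c_h^1\|^2\big)+C\tau\sum_{n=1}^{N-1}\big(\|\mathbf f^n\|^2+|\Omega|\big).$$ -/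

import Mathlib

open MeasureTheory Filter Topology
open scoped ContDiff

noncomputable section

namespace Bioconvection

/-- Euclidean space `ℝ^d`. -/
abbrev Eu (d : ℕ) := EuclideanSpace ℝ (Fin d)

variable {d : ℕ}

/-- The `i`-th standard unit vector. -/
def unitVec (i : Fin d) : Eu d := EuclideanSpace.single i (1 : ℝ)

/-! ### Sobolev spaces through weak derivatives

Functions on `Ω` (or on its closure) are represented by functions on all of `ℝ^d`, whose values
outside the closure of `Ω` play no role. -/

/-- `φ ∈ C_c^∞(Ω)`. -/
structure IsTestFun (Ω : Set (Eu d)) (φ : Eu d → ℝ) : Prop where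
  smooth : ContDiff ℝ ∞ φ
  compact : HasCompactSupport φ
  support_subset : tsupport φ ⊆ Ω

/-- `v ∈ L²(Ω)`. -/
def MemL2 {F : Type*} [NormedAddCommGroup F] (Ω : Set (Eu d)) (v : Eu d → F) : Prop :=
  MemLp v 2 (volume.restrict Ω)

/-- `g ∈ L²(Ω)` is a weak partial derivative of `v` on `Ω` in the direction of the `i`-th
coordinate. -/
def IsWeakDeriv (Ω : Set (Eu d)) (i : Fin d) (v g : Eu d → ℝ) : Prop :=
  MemL2 Ω g ∧ ∀ φ, IsTestFun Ω φ →
    ∫ x in Ω, v x * fderiv ℝ φ x (unitVec i) = -∫ x in Ω, g x * φ x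

/-- `v ∈ H¹(Ω)`. -/
def MemH1 (Ω : Set (Eu d)) (v : Eu d → ℝ) : Prop :=
  MemL2 Ω v ∧ ∀ i, ∃ g, IsWeakDeriv Ω i v g

open Classical in
/-- The weak partial derivative `∂v/∂x_i` of `v ∈ H¹(Ω)` (a representative of it; it is unique
almost everywhere on `Ω`). -/
def wd (Ω : Set (Eu d)) (i : Fin d) (v : Eu d → ℝ) : Eu d → ℝ :=
  if h : ∃ g, IsWeakDeriv Ω i v g then h.choose else 0

/-- `v ∈ H¹₀(Ω)`: the closure of `C_c^∞(Ω)` in `H¹(Ω)`. -/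
def MemH10 (Ω : Set (Eu d)) (v : Eu d → ℝ) : Prop :=
  MemH1 Ω v ∧ ∃ φ : ℕ → Eu d → ℝ, (∀ k, IsTestFun Ω (φ k)) ∧
    Tendsto (fun k => ∫ x in Ω, (φ k x - v x) ^ 2) atTop (𝓝 0) ∧
    ∀ i, Tendsto (fun k => ∫ x in Ω, (fderiv ℝ (φ k) x (unitVec i) - wd Ω i v x) ^ 2)
      atTop (𝓝 0)

/-- The velocity space `𝐕 = H¹₀(Ω)^d`. -/
def MemV (Ω : Set (Eu d)) (v : Eu d → Eu d) : Prop :=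
  ∀ i, MemH10 Ω (fun x => v x i)

/-- The pressure space `M = L²₀(Ω)`. -/
def MemM (Ω : Set (Eu d)) (q : Eu d → ℝ) : Prop :=
  MemL2 Ω q ∧ ∫ x in Ω, q x = 0

/-- The concentration space `H̃ = H¹(Ω) ∩ L²₀(Ω)`. -/
def MemHt (Ω : Set (Eu d)) (r : Eu d → ℝ) : Prop :=
  MemH1 Ω r ∧ MemM Ω r

/-! ### Norms, differential operators and forms -/

/-- `‖v‖²` in `L²(Ω)`. -/
def l2Sq {F : Type*} [NormedAddCommGroup F] (Ω : Set (Eu d)) (v : Eu d → F) : ℝ :=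
  ∫ x in Ω, ‖v x‖ ^ 2

/-- `‖∇r‖²` in `L²(Ω)` for a scalar function. -/
def gradSq (Ω : Set (Eu d)) (r : Eu d → ℝ) : ℝ :=
  ∑ j, ∫ x in Ω, wd Ω j r x ^ 2

/-- `‖∇v‖²` in `L²(Ω)` for a vector field. -/
def vgradSq (Ω : Set (Eu d)) (v : Eu d → Eu d) : ℝ :=
  ∑ i, gradSq Ω (fun x => v x i)

/-- The (weak) divergence. -/
def wdiv (Ω : Set (Eu d)) (v : Eu d → Eu d) (x : Eu d) : ℝ :=
  ∑ i, wd Ω i (fun y => v y i) x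

/-- `𝐀(c, u, v) = (ν(c + α) ∇u, ∇v)`. -/
def formA (Ω : Set (Eu d)) (ν : ℝ → ℝ) (α : ℝ) (c : Eu d → ℝ) (u v : Eu d → Eu d) : ℝ :=
  ∫ x in Ω, ν (c x + α) *
    ∑ i, ∑ j, wd Ω j (fun y => u y i) x * wd Ω j (fun y => v y i) x

/-- `b(u, c, r) = ∫ (u · ∇c) r + (1/2) ∫ (∇ · u) c r`. -/
def formb (Ω : Set (Eu d)) (u : Eu d → Eu d) (c r : Eu d → ℝ) : ℝ :=
  (∫ x in Ω, (∑ j, u x j * wd Ω j c x) * r x) + 1 / 2 * ∫ x in Ω, wdiv Ω u x * c x * r x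

/-- `B(u, v, w) = ∫ (u · ∇v) · w + (1/2) ∫ (∇ · u) v · w`. -/
def formB (Ω : Set (Eu d)) (u v w : Eu d → Eu d) : ℝ :=
  (∫ x in Ω, ∑ i, (∑ j, u x j * wd Ω j (fun y => v y i) x) * w x i) +
    1 / 2 * ∫ x in Ω, wdiv Ω u x * inner ℝ (v x) (w x)

/-! ### Triangulations and finite element spaces -/

/-- `K` is a (conforming) triangulation of `Ω`: a finite simplicial complex, all of whose maximal
simplices are `d`-dimensional, which covers the closure of `Ω` and whose open elements lie
in `Ω`. -/
structure IsTriangulation (Ω : Set (Eu d)) (K : Geometry.SimplicialComplex ℝ (Eu d)) : Prop where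
  finite : K.faces.Finite
  pure : ∀ s ∈ K.faces, ∃ t ∈ K.faces, s ⊆ t ∧ t.card = d + 1
  space_eq : K.space = closure Ω
  interior_subset : ∀ s ∈ K.faces, interior (convexHull ℝ (s : Set (Eu d))) ⊆ Ω

/-- The elements (given by their vertices) of a triangulation. -/
def elements (K : Geometry.SimplicialComplex ℝ (Eu d)) : Set (Finset (Eu d)) :=
  {s | s ∈ K.faces ∧ s.card = d + 1}

open Classical in
/-- The bubble function of the element with vertex set `s`: the product of its barycentric
coordinates. -/
def bubble (s : Finset (Eu d)) (x : Eu d) : ℝ :=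
  if h : AffineIndependent ℝ (fun a : s => (a : Eu d)) ∧
      affineSpan ℝ (Set.range fun a : s => (a : Eu d)) = ⊤ then
    ∏ a : s, (AffineBasis.mk (fun a : s => (a : Eu d)) h.1 h.2).coord a x
  else 0

/-- The restriction of `r` to the element with vertex set `s` is in `P₁`. -/
def IsP1On (s : Finset (Eu d)) (r : Eu d → ℝ) : Prop :=
  ∃ l : Eu d →ᵃ[ℝ] ℝ, ∀ x ∈ convexHull ℝ (s : Set (Eu d)), r x = l x

/-- The restriction of `r` to the element with vertex set `s` is in `P₁ ⊕ span {bubble}`. -/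
def IsP1bOn (s : Finset (Eu d)) (r : Eu d → ℝ) : Prop :=
  ∃ (l : Eu d →ᵃ[ℝ] ℝ) (k : ℝ), ∀ x ∈ convexHull ℝ (s : Set (Eu d)), r x = l x + k * bubble s x

/-- The velocity space `𝐕_h` of the mini element. -/
structure MemVh (Ω : Set (Eu d)) (K : Geometry.SimplicialComplex ℝ (Eu d))
    (v : Eu d → Eu d) : Prop where
  cont : ContinuousOn v (closure Ω)
  memV : MemV Ω v
  poly : ∀ s ∈ elements K, ∀ i, IsP1bOn s (fun x => v x i)

/-- The pressure space `M_h`. -/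
structure MemMh (Ω : Set (Eu d)) (K : Geometry.SimplicialComplex ℝ (Eu d))
    (q : Eu d → ℝ) : Prop where
  cont : ContinuousOn q (closure Ω)
  memH1 : MemH1 Ω q
  poly : ∀ s ∈ elements K, IsP1On s q
  mean : ∫ x in Ω, q x = 0

/-- The concentration space `H̃_h`. -/
structure MemHth (Ω : Set (Eu d)) (K : Geometry.SimplicialComplex ℝ (Eu d))
    (r : Eu d → ℝ) : Prop where
  cont : ContinuousOn r (closure Ω)
  memHt : MemHt Ω r
  poly : ∀ s ∈ elements K, IsP1On s r

/-! ### Viscosity and the scheme -/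

/-- The viscosity assumption: `κ ≤ ν ≤ κ⁻¹` and `ν` is Lipschitz with constant `β`. -/
structure ViscosityAssumption (κ β : ℝ) (ν : ℝ → ℝ) : Prop where
  lower : ∀ x, κ ≤ ν x
  upper : ∀ x, ν x ≤ κ⁻¹
  lipschitz : ∀ x₁ x₂, |ν x₁ - ν x₂| ≤ β * |x₁ - x₂|

/-- `(u n, p n, c n)` is a solution of the (three-level part of the) decoupled Crank–Nicolson
Leap–Frog scheme with time step `τ` and `N` steps. The direction of gravity is minus the `e`-th
coordinate direction, and `f n` is the force at the time level `n`. -/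
structure IsCNLFSolution (Ω : Set (Eu d)) (K : Geometry.SimplicialComplex ℝ (Eu d)) (e : Fin d)
    (ν : ℝ → ℝ) (α g γ θ U τ : ℝ) (N : ℕ) (f : ℕ → Eu d → Eu d)
    (u : ℕ → Eu d → Eu d) (p c : ℕ → Eu d → ℝ) : Prop where
  memu : ∀ n ≤ N, MemVh Ω K (u n)
  memp : ∀ n, 1 ≤ n → n ≤ N → MemMh Ω K (p n)
  memc : ∀ n ≤ N, MemHth Ω K (c n)
  momentum : ∀ n, 1 ≤ n → n + 1 ≤ N → ∀ v, MemVh Ω K v →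
    (∫ x in Ω, inner ℝ ((2 * τ)⁻¹ • (u (n + 1) x - u (n - 1) x)) (v x))
      + formA Ω ν α (c n) (fun x => (2 : ℝ)⁻¹ • (u (n + 1) x + u (n - 1) x)) v
      + formB Ω (u n) (fun x => (2 : ℝ)⁻¹ • (u (n + 1) x + u (n - 1) x)) v
      - (∫ x in Ω, p n x * wdiv Ω v x)
    = -(∫ x in Ω, inner ℝ ((g * (1 + γ * c n x)) • unitVec e) (v x))
      + ∫ x in Ω, inner ℝ (f n x) (v x)
  incompressible : ∀ n, 1 ≤ n → n + 1 ≤ N → ∀ q, MemMh Ω K q →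
    ∫ x in Ω, wdiv Ω (fun y => (2 : ℝ)⁻¹ • (u (n + 1) y + u (n - 1) y)) x * q x = 0
  concentration : ∀ n, 1 ≤ n → n + 1 ≤ N → ∀ r, MemHth Ω K r →
    (∫ x in Ω, (c (n + 1) x - c (n - 1) x) / (2 * τ) * r x)
      + θ * (∫ x in Ω, ∑ j, wd Ω j (fun y => (c (n + 1) y + c (n - 1) y) / 2) x * wd Ω j r x)
      + formb Ω (u n) (fun x => (c (n + 1) x + c (n - 1) x) / 2) r
      - U * (∫ x in Ω, c n x * wd Ω e r x)
    = U * α * ∫ x in Ω, wd Ω e r x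

end Bioconvection

end

open MeasureTheory Filter Topology
open scoped ContDiff

noncomputable section

namespace Bioconvection

variable {d : ℕ} {Ω : Set (Eu d)}

/-! ### Weak derivatives -/

/-! The proof is an energy argument: each equation is tested with the average of the levels `n + 1`
and `n - 1` of its own unknown. The leapfrog difference then becomes `(4 * τ)⁻¹` times a difference
of squared norms, the convective term vanishes by skew-symmetry (`formb_self`, `formB_self`), and
the pressure term vanishes because `p n` is admissible in the discrete divergence constraint. What
remains is coercive viscosity and diffusion (`le_formA_self`) against forcing. Young's inequality,
with the Poincaré inequality for the velocity, absorbs part of the forcing into half of the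
dissipation; the rest involves only data and `c n`.

Since the step couples levels `n + 1` and `n - 1`, the energy is summed over two consecutive levels.
The coupling through `c n` is explicit, so it is bounded by the previous energy, and
`discrete_gronwall` applies with growth factor `1 + L * τ` for every `τ > 0`. Over at most `N` steps
the growth stays below `exp (L * T)`.

The analytic core is the skew-symmetry for functions known only through weak derivatives. It
requires the product rule for `c ^ 2` (`IsWeakDeriv.sq`), available because discrete functions are
continuous on the compact closure of `Ω` and hence bounded, and integration by parts against `H¹₀`
(`MemH10.integral_mul_eq_neg`). -/

lemma integrable_mul_of_memLp_two {X : Type*} [MeasurableSpace X] {μ : Measure X} {f g : X → ℝ}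
    (hf : MemLp f 2 μ) (hg : MemLp g 2 μ) : Integrable (fun x => f x * g x) μ :=
  hf.integrable_mul hg

lemma IsTestFun.memLp {φ : Eu d → ℝ} (hφ : IsTestFun Ω φ) :
    MemLp φ 2 (volume.restrict Ω) :=
  (hφ.smooth.continuous.memLp_of_hasCompactSupport hφ.compact).restrict Ω

lemma IsTestFun.continuous_fderiv_apply {φ : Eu d → ℝ} (hφ : IsTestFun Ω φ) (e : Eu d) :
    Continuous fun x => fderiv ℝ φ x e :=
  (hφ.smooth.continuous_fderiv (by simp)).clm_apply continuous_const

lemma IsTestFun.hasCompactSupport_fderiv_apply {φ : Eu d → ℝ} (hφ : IsTestFun Ω φ) (e : Eu d) :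
    HasCompactSupport fun x => fderiv ℝ φ x e :=
  hφ.compact.fderiv_apply (𝕜 := ℝ) e

lemma IsTestFun.memLp_fderiv_apply {φ : Eu d → ℝ} (hφ : IsTestFun Ω φ) (e : Eu d) :
    MemLp (fun x => fderiv ℝ φ x e) 2 (volume.restrict Ω) :=
  ((hφ.continuous_fderiv_apply e).memLp_of_hasCompactSupport
    (hφ.hasCompactSupport_fderiv_apply e)).restrict Ω

lemma IsTestFun.linComb {φ ψ : Eu d → ℝ} (hφ : IsTestFun Ω φ) (hψ : IsTestFun Ω ψ) (a b : ℝ) :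
    IsTestFun Ω (fun x => a * φ x + b * ψ x) where
  smooth := (contDiff_const.mul hφ.smooth).add (contDiff_const.mul hψ.smooth)
  compact := (hφ.compact.mul_left (f := fun _ => a)).add (hψ.compact.mul_left (f := fun _ => b))
  support_subset := by
    refine (tsupport_add (fun x => a * φ x) (fun x => b * ψ x)).trans (Set.union_subset ?_ ?_)
    · exact (tsupport_mul_subset_right (f := fun _ => a)).trans hφ.support_subset
    · exact (tsupport_mul_subset_right (f := fun _ => b)).trans hψ.support_subset

lemma isWeakDeriv_wd {v : Eu d → ℝ} (hv : MemH1 Ω v) (i : Fin d) :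
    IsWeakDeriv Ω i v (wd Ω i v) := by
  have h := hv.2 i
  rw [wd, dif_pos h]
  exact h.choose_spec

lemma memLp_wd {v : Eu d → ℝ} (hv : MemH1 Ω v) (i : Fin d) :
    MemLp (wd Ω i v) 2 (volume.restrict Ω) :=
  (isWeakDeriv_wd hv i).1

/-- Weak derivatives are unique almost everywhere. -/
lemma IsWeakDeriv.ae_eq (hΩ : IsOpen Ω) {i : Fin d} {v g g' : Eu d → ℝ}
    (h : IsWeakDeriv Ω i v g) (h' : IsWeakDeriv Ω i v g') :
    g =ᵐ[volume.restrict Ω] g' := by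
  have hm : MemLp (fun x => g x - g' x) 2 (volume.restrict Ω) := h.1.sub h'.1
  have key := hΩ.ae_eq_zero_of_integral_contDiff_smul_eq_zero (μ := volume)
    (f := fun x => g x - g' x) ?_ ?_
  · filter_upwards [(ae_restrict_iff' hΩ.measurableSet).2 key] with x hx
    linarith
  · exact locallyIntegrableOn_of_locallyIntegrable_restrict
      (hm.locallyIntegrable one_le_two)
  · intro φ h1 h2 h3
    have hφ : IsTestFun Ω φ := ⟨h1, h2, h3⟩
    rw [← setIntegral_eq_integral_of_forall_compl_eq_zero (s := Ω)]
    · have e : ∀ x, φ x • (g x - g' x) = g x * φ x - g' x * φ x := fun x => by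
        simp only [smul_eq_mul]; ring
      simp_rw [e]
      rw [integral_sub (integrable_mul_of_memLp_two h.1 hφ.memLp)
        (integrable_mul_of_memLp_two h'.1 hφ.memLp)]
      have e1 := h.2 φ hφ
      have e2 := h'.2 φ hφ
      linarith
    · intro x hx
      rw [image_eq_zero_of_notMem_tsupport (fun hh => hx (h3 hh)), zero_smul]

lemma IsWeakDeriv.linComb {i : Fin d} {v w g k : Eu d → ℝ}
    (hv : MemL2 Ω v) (hw : MemL2 Ω w) (h : IsWeakDeriv Ω i v g) (h' : IsWeakDeriv Ω i w k)
    (a b : ℝ) :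
    IsWeakDeriv Ω i (fun x => a * v x + b * w x) (fun x => a * g x + b * k x) := by
  refine ⟨(h.1.const_mul a).add (h'.1.const_mul b), fun φ hφ => ?_⟩
  have hd := hφ.memLp_fderiv_apply (unitVec i)
  have e1 : ∀ x, (a * v x + b * w x) * fderiv ℝ φ x (unitVec i) =
      a * (v x * fderiv ℝ φ x (unitVec i)) + b * (w x * fderiv ℝ φ x (unitVec i)) :=
    fun x => by ring
  have e2 : ∀ x, (a * g x + b * k x) * φ x = a * (g x * φ x) + b * (k x * φ x) :=
    fun x => by ring
  simp_rw [e1, e2]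
  rw [integral_add ((integrable_mul_of_memLp_two hv hd).const_mul a)
      ((integrable_mul_of_memLp_two hw hd).const_mul b),
    integral_add ((integrable_mul_of_memLp_two h.1 hφ.memLp).const_mul a)
      ((integrable_mul_of_memLp_two h'.1 hφ.memLp).const_mul b)]
  simp_rw [integral_const_mul]
  rw [h.2 φ hφ, h'.2 φ hφ]
  ring

lemma MemH1.linComb {v w : Eu d → ℝ} (hv : MemH1 Ω v) (hw : MemH1 Ω w) (a b : ℝ) :
    MemH1 Ω (fun x => a * v x + b * w x) :=
  ⟨(hv.1.const_mul a).add (hw.1.const_mul b), fun i =>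
    ⟨_, (isWeakDeriv_wd hv i).linComb hv.1 hw.1 (isWeakDeriv_wd hw i) a b⟩⟩

/-- `wd` is an arbitrarily chosen representative, so linearity comes from uniqueness and holds only
almost everywhere. -/
lemma wd_linComb (hΩ : IsOpen Ω) {v w : Eu d → ℝ} (hv : MemH1 Ω v) (hw : MemH1 Ω w) (a b : ℝ)
    (i : Fin d) :
    wd Ω i (fun x => a * v x + b * w x) =ᵐ[volume.restrict Ω]
      fun x => a * wd Ω i v x + b * wd Ω i w x :=
  (isWeakDeriv_wd (hv.linComb hw a b) i).ae_eq hΩ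
    ((isWeakDeriv_wd hv i).linComb hv.1 hw.1 (isWeakDeriv_wd hw i) a b)

/-- `L²` convergence is preserved by linear combinations. -/
lemma tendsto_integral_sq_linComb {X : Type*} [MeasurableSpace X] {μ : Measure X}
    {φ ψ : ℕ → X → ℝ} {v w : X → ℝ} (a b : ℝ)
    (hφ : ∀ k, MemLp (φ k) 2 μ) (hψ : ∀ k, MemLp (ψ k) 2 μ) (hv : MemLp v 2 μ) (hw : MemLp w 2 μ)
    (h1 : Tendsto (fun k => ∫ x, (φ k x - v x) ^ 2 ∂μ) atTop (𝓝 0))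
    (h2 : Tendsto (fun k => ∫ x, (ψ k x - w x) ^ 2 ∂μ) atTop (𝓝 0)) :
    Tendsto (fun k => ∫ x, (a * φ k x + b * ψ k x - (a * v x + b * w x)) ^ 2 ∂μ)
      atTop (𝓝 0) := by
  have h3 : Tendsto (fun k => 2 * a ^ 2 * (∫ x, (φ k x - v x) ^ 2 ∂μ)
      + 2 * b ^ 2 * ∫ x, (ψ k x - w x) ^ 2 ∂μ) atTop (𝓝 0) := by
    simpa using (h1.const_mul (2 * a ^ 2)).add (h2.const_mul (2 * b ^ 2))
  refine squeeze_zero (fun k => integral_nonneg fun x => sq_nonneg _) (fun k => ?_) h3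
  have i1 : Integrable (fun x => (φ k x - v x) ^ 2) μ := ((hφ k).sub hv).integrable_sq
  have i2 : Integrable (fun x => (ψ k x - w x) ^ 2) μ := ((hψ k).sub hw).integrable_sq
  have i3 := (((hφ k).const_mul a).add ((hψ k).const_mul b)).sub
    ((hv.const_mul a).add (hw.const_mul b))
  rw [← integral_const_mul, ← integral_const_mul,
    ← integral_add (i1.const_mul _) (i2.const_mul _)]
  refine integral_mono i3.integrable_sq ((i1.const_mul _).add (i2.const_mul _)) fun x => ?_
  nlinarith [sq_nonneg (a * (φ k x - v x) - b * (ψ k x - w x))]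

lemma MemH10.linComb (hΩ : IsOpen Ω) {v w : Eu d → ℝ} (hv : MemH10 Ω v) (hw : MemH10 Ω w)
    (a b : ℝ) : MemH10 Ω (fun x => a * v x + b * w x) := by
  obtain ⟨hv1, φ, hφ, hφ0, hφ1⟩ := hv
  obtain ⟨hw1, ψ, hψ, hψ0, hψ1⟩ := hw
  refine ⟨hv1.linComb hw1 a b, fun k x => a * φ k x + b * ψ k x,
    fun k => (hφ k).linComb (hψ k) a b, ?_, fun i => ?_⟩
  · exact tendsto_integral_sq_linComb a b (fun k => (hφ k).memLp) (fun k => (hψ k).memLp)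
      hv1.1 hw1.1 hφ0 hψ0
  · refine (tendsto_integral_sq_linComb a b (fun k => (hφ k).memLp_fderiv_apply (unitVec i))
      (fun k => (hψ k).memLp_fderiv_apply (unitVec i)) (memLp_wd hv1 i) (memLp_wd hw1 i)
      (hφ1 i) (hψ1 i)).congr fun k => ?_
    refine integral_congr_ae ?_
    filter_upwards [wd_linComb hΩ hv1 hw1 a b i] with x hx
    have d1 : DifferentiableAt ℝ (φ k) x := (hφ k).smooth.differentiable (by simp) x
    have d2 : DifferentiableAt ℝ (ψ k) x := (hψ k).smooth.differentiable (by simp) x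
    rw [hx, fderiv_fun_add (d1.const_mul a) (d2.const_mul b), fderiv_const_mul d1,
      fderiv_const_mul d2]
    simp

/-- Strong `L²` convergence implies convergence of the integrals against an `L²` function. -/
lemma tendsto_integral_mul_of_tendsto_integral_sq {X : Type*} [MeasurableSpace X] {μ : Measure X}
    {φ : ℕ → X → ℝ} {v t : X → ℝ} (hφ : ∀ k, MemLp (φ k) 2 μ) (hv : MemLp v 2 μ)
    (ht : MemLp t 2 μ) (h : Tendsto (fun k => ∫ x, (φ k x - v x) ^ 2 ∂μ) atTop (𝓝 0)) :
    Tendsto (fun k => ∫ x, φ k x * t x ∂μ) atTop (𝓝 (∫ x, v x * t x ∂μ)) := by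
  rw [tendsto_iff_norm_sub_tendsto_zero]
  have hs : Tendsto (fun k => (∫ x, (φ k x - v x) ^ 2 ∂μ) ^ (1 / 2 : ℝ) *
      (∫ x, t x ^ 2 ∂μ) ^ (1 / 2 : ℝ)) atTop (𝓝 0) := by
    have := (h.rpow_const (p := (1 / 2 : ℝ)) (Or.inr (by norm_num))).mul_const
      ((∫ x, t x ^ 2 ∂μ) ^ (1 / 2 : ℝ))
    simpa using this
  refine squeeze_zero (fun k => norm_nonneg _) (fun k => ?_) hs
  have hk : MemLp (fun x => φ k x - v x) 2 μ := (hφ k).sub hv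
  rw [← integral_sub (integrable_mul_of_memLp_two (hφ k) ht) (integrable_mul_of_memLp_two hv ht)]
  calc ‖∫ x, (φ k x * t x - v x * t x) ∂μ‖
      ≤ ∫ x, ‖φ k x * t x - v x * t x‖ ∂μ := norm_integral_le_integral_norm _
    _ = ∫ x, |φ k x - v x| * |t x| ∂μ := by
        refine integral_congr_ae (Eventually.of_forall fun x => ?_)
        simp only [← sub_mul, norm_mul, Real.norm_eq_abs]
    _ ≤ _ := by
        have := integral_mul_le_Lp_mul_Lq_of_nonneg (μ := μ) (p := 2) (q := 2)
          Real.HolderConjugate.two_two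
          (f := fun x => |φ k x - v x|) (g := fun x => |t x|)
          (Eventually.of_forall fun x => abs_nonneg _) (Eventually.of_forall fun x => abs_nonneg _)
          (by rw [ENNReal.ofReal_ofNat]; exact hk.abs)
          (by rw [ENNReal.ofReal_ofNat]; exact ht.abs)
        simpa using this

/-- Integration by parts against a function of `H¹₀(Ω)`. -/
lemma MemH10.integral_mul_eq_neg {v s t : Eu d → ℝ} (hv : MemH10 Ω v) {i : Fin d}
    (hs : MemL2 Ω s) (hst : IsWeakDeriv Ω i s t) :
    ∫ x in Ω, v x * t x = -∫ x in Ω, wd Ω i v x * s x := by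
  obtain ⟨hv1, φ, hφ, hφ0, hφ1⟩ := hv
  have l1 := tendsto_integral_mul_of_tendsto_integral_sq (fun k => (hφ k).memLp) hv1.1 hst.1 hφ0
  have l2 := tendsto_integral_mul_of_tendsto_integral_sq
    (fun k => (hφ k).memLp_fderiv_apply (unitVec i)) (memLp_wd hv1 i) hs (hφ1 i)
  -- For test functions the identity is the definition of a weak derivative; both sides pass to the
  -- `H¹` limit.
  refine tendsto_nhds_unique l1 (l2.neg.congr fun k => ?_)
  have := hst.2 (φ k) (hφ k)
  simp_rw [mul_comm (fderiv ℝ (φ k) _ _), mul_comm (φ k _)]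
  linarith

/-! ### Mollification and the weak derivative of a square -/

/-- The convolution of `k` with the normalized bump function `φ`. -/
def mollify (φ : ContDiffBump (0 : Eu d)) (k : Eu d → ℝ) : Eu d → ℝ :=
  convolution k (φ.normed volume) (ContinuousLinearMap.mul ℝ ℝ) volume

/-- Differentiation lands on the second factor of a convolution, while the approximation results for
bump functions have the bump first; both forms are needed. -/
lemma mollify_eq_convolution (φ : ContDiffBump (0 : Eu d)) (k : Eu d → ℝ) :
    mollify φ k =
      convolution (φ.normed volume) k (ContinuousLinearMap.lsmul ℝ ℝ) volume := by
  rw [mollify, ← convolution_flip]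
  congr 1
  ext
  simp

lemma contDiff_mollify (φ : ContDiffBump (0 : Eu d)) {k : Eu d → ℝ} (hk : Continuous k) :
    ContDiff ℝ ∞ (mollify φ k) :=
  φ.hasCompactSupport_normed.contDiff_convolution_right _ hk.locallyIntegrable φ.contDiff_normed

lemma fderiv_mollify_apply (φ : ContDiffBump (0 : Eu d)) {k : Eu d → ℝ} (hk : Continuous k)
    (x e : Eu d) :
    fderiv ℝ (mollify φ k) x e = ∫ y, k y * fderiv ℝ (φ.normed volume) (x - y) e := by
  have hρ : ContDiff ℝ 1 (φ.normed (volume : Measure (Eu d))) := φ.contDiff_normed (n := 1)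
  have h := φ.hasCompactSupport_normed.hasFDerivAt_convolution_right
    (ContinuousLinearMap.mul ℝ ℝ) (hk.locallyIntegrable (μ := volume)) hρ x
  rw [mollify, h.fderiv, convolution_precompR_apply _ hk.locallyIntegrable
    (φ.hasCompactSupport_normed.fderiv ℝ) (hρ.continuous_fderiv (by simp))]
  rfl

/-- The bump is even, so its derivative is odd. This is the source of the antisymmetry below. -/
lemma fderiv_normed_neg_apply (φ : ContDiffBump (0 : Eu d)) (x e : Eu d) :
    fderiv ℝ (φ.normed volume) (-x) e = -fderiv ℝ (φ.normed volume) x e := by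
  have h : (fun y => φ.normed volume (-y)) = φ.normed (volume : Measure (Eu d)) :=
    funext fun y => φ.normed_neg y
  have hρ : ContDiff ℝ 1 (φ.normed (volume : Measure (Eu d))) := φ.contDiff_normed (n := 1)
  have h2 : HasFDerivAt (fun y => φ.normed volume (-y)) _ x :=
    ((hρ.differentiable one_ne_zero (-x)).hasFDerivAt).comp x (hasFDerivAt_id x).neg
  rw [h] at h2
  rw [h2.fderiv]
  simp

/-- The derivative of a mollification is antisymmetric. -/
lemma integral_mul_fderiv_mollify (φ : ContDiffBump (0 : Eu d)) {k w : Eu d → ℝ}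
    (hk : Continuous k) (hk' : HasCompactSupport k) (hw : Continuous w)
    (hw' : HasCompactSupport w) (e : Eu d) :
    ∫ x, w x * fderiv ℝ (mollify φ k) x e = -∫ x, k x * fderiv ℝ (mollify φ w) x e := by
  have hρ : ContDiff ℝ 1 (φ.normed (volume : Measure (Eu d))) := φ.contDiff_normed (n := 1)
  have hρ' : Continuous fun x => fderiv ℝ (φ.normed (volume : Measure (Eu d))) x e :=
    (hρ.continuous_fderiv (by simp)).clm_apply continuous_const
  simp_rw [fderiv_mollify_apply φ hk, fderiv_mollify_apply φ hw, ← integral_const_mul]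
  rw [integral_integral_swap_of_hasCompactSupport]
  · rw [← integral_neg]
    refine integral_congr_ae (Eventually.of_forall fun y => ?_)
    simp only [← integral_neg]
    refine integral_congr_ae (Eventually.of_forall fun x => ?_)
    simp only
    rw [← neg_sub y x, fderiv_normed_neg_apply]
    ring
  · exact (hw.comp continuous_fst).mul ((hk.comp continuous_snd).mul
      (hρ'.comp (continuous_fst.sub continuous_snd)))
  · refine HasCompactSupport.intro (hw'.isCompact.prod hk'.isCompact) fun p hp => ?_
    rw [Set.mem_prod, not_and_or] at hp
    rcases hp with hp | hp
    · simp [Function.uncurry, image_eq_zero_of_notMem_tsupport hp]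
    · simp [Function.uncurry, image_eq_zero_of_notMem_tsupport hp]

lemma mollify_eq_zero (φ : ContDiffBump (0 : Eu d)) {w : Eu d → ℝ} {x : Eu d}
    (hx : x ∉ Metric.cthickening φ.rOut (tsupport w)) : mollify φ w x = 0 := by
  have : ∀ y, w y * φ.normed volume (x - y) = 0 := fun y => by
    by_cases hy : y ∈ tsupport w
    · have : x - y ∉ Function.support (φ.normed (volume : Measure (Eu d))) := by
        rw [φ.support_normed_eq, mem_ball_zero_iff, not_lt]
        by_contra! hlt
        exact hx (Metric.mem_cthickening_of_dist_le x y _ _ hy (by rw [dist_eq_norm]; exact hlt.le))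
      rw [Function.notMem_support.1 this, mul_zero]
    · rw [image_eq_zero_of_notMem_tsupport hy, zero_mul]
  change ∫ y, w y * φ.normed volume (x - y) = 0
  simp [this]

lemma tsupport_mollify_subset (φ : ContDiffBump (0 : Eu d)) (w : Eu d → ℝ) :
    tsupport (mollify φ w) ⊆ Metric.cthickening φ.rOut (tsupport w) := by
  refine closure_minimal (fun x hx => ?_) Metric.isClosed_cthickening
  by_contra h
  exact hx (mollify_eq_zero φ h)

/-- The oscillation of `w` is at most `2 * M`, so mollifying moves it by at most that much. The
constant is not sharp; only uniformity in `φ` matters, for dominated convergence. -/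
lemma abs_mollify_le (φ : ContDiffBump (0 : Eu d)) {w : Eu d → ℝ} (hw : Continuous w) {M : ℝ}
    (hM : ∀ x, |w x| ≤ M) (x : Eu d) : |mollify φ w x| ≤ 3 * M := by
  have h := φ.dist_normed_convolution_le (μ := volume) (x₀ := x) (ε := 2 * M)
    hw.aestronglyMeasurable fun y _ => by
      rw [Real.dist_eq]
      linarith [abs_sub (w y) (w x), hM x, hM y]
  rw [← mollify_eq_convolution, Real.dist_eq] at h
  have := abs_sub_abs_le_abs_sub (mollify φ w x) (w x)
  linarith [hM x]

/-- Integrals against mollifications converge. -/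
lemma tendsto_integral_mul_mollify {φ : ℕ → ContDiffBump (0 : Eu d)}
    (hφ : Tendsto (fun n => (φ n).rOut) atTop (𝓝 0)) {w : Eu d → ℝ} (hw : Continuous w)
    (hw' : HasCompactSupport w) {μ : Measure (Eu d)} {F : Eu d → ℝ} (hF : Integrable F μ) :
    Tendsto (fun n => ∫ x, F x * mollify (φ n) w x ∂μ) atTop (𝓝 (∫ x, F x * w x ∂μ)) := by
  obtain ⟨M, hM⟩ := hw'.exists_bound_of_continuous hw
  refine tendsto_integral_of_dominated_convergence (fun x => |F x| * (3 * M)) (fun n => ?_)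
    (hF.abs.mul_const _) (fun n => Eventually.of_forall fun x => ?_)
    (Eventually.of_forall fun x => ?_)
  · exact hF.aestronglyMeasurable.mul (contDiff_mollify (φ n) hw).continuous.aestronglyMeasurable
  · rw [norm_mul]
    exact mul_le_mul_of_nonneg_left (abs_mollify_le (φ n) hw hM x) (abs_nonneg _)
  · refine Tendsto.const_mul _ ?_
    simp_rw [mollify_eq_convolution]
    exact ContDiffBump.convolution_tendsto_right_of_continuous hφ hw x

/-- The square of a continuous bounded function with a weak derivative `G` has the weak
derivative `2 c G`. -/
lemma IsWeakDeriv.sq (hΩ : IsOpen Ω) (hΩb : Bornology.IsBounded Ω) {i : Fin d}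
    {c G : Eu d → ℝ} (hc : ContinuousOn c Ω) {M : ℝ} (hM : ∀ x ∈ Ω, |c x| ≤ M) (h : IsWeakDeriv Ω i c G) :
    IsWeakDeriv Ω i (fun x => c x ^ 2) (fun x => 2 * (c x * G x)) := by
  have : IsFiniteMeasure (volume.restrict Ω) :=
    isFiniteMeasure_restrict.2 hΩb.measure_lt_top.ne
  have hcm : AEStronglyMeasurable c (volume.restrict Ω) :=
    hc.aestronglyMeasurable hΩ.measurableSet
  have hcM : ∀ᵐ x ∂volume.restrict Ω, ‖c x‖ ≤ M :=
    (ae_restrict_iff' hΩ.measurableSet).2 (Eventually.of_forall hM)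
  have hcG : MemLp (fun x => c x * G x) 2 (volume.restrict Ω) := by
    refine MemLp.of_le_mul (c := M) h.1 (hcm.mul h.1.1) ?_
    filter_upwards [hcM] with x hx
    rw [norm_mul]
    exact mul_le_mul_of_nonneg_right hx (norm_nonneg _)
  -- Duality argument, avoiding convergence of mollified derivatives. Let `K`, `W` be the
  -- mollifications of `k = c ζ` and `w = c φ`. Testing `c` with `K φ` produces `∫ w ∂K`, which
  -- equals `-∫ k ∂W` by antisymmetry and then `∫ G W` by testing `c` with `W`. Only
  -- undifferentiated mollifications remain, and the limit gives `∫ c² ∂φ + ∫ G c φ = -∫ G φ c`.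
  refine ⟨hcG.const_mul 2, fun φ hφ => ?_⟩
  set e := unitVec i
  obtain ⟨δ, hδ, hδΩ⟩ := hφ.compact.isCompact.exists_cthickening_subset_open hΩ hφ.support_subset
  -- a continuous cutoff which is `1` near the support of `φ`
  obtain ⟨ζ, hζ1, hζ0, hζc, -⟩ := exists_continuous_one_zero_of_isCompact
    (s := Metric.cthickening (δ / 2) (tsupport φ)) (t := (Metric.thickening δ (tsupport φ))ᶜ)
    hφ.compact.isCompact.cthickening Metric.isOpen_thickening.isClosed_compl
    (Set.disjoint_compl_right_iff_subset.2
      (Metric.cthickening_subset_thickening' hδ (by linarith) _))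
  have hζΩ : tsupport ζ ⊆ Ω := by
    refine (closure_minimal (fun x hx => ?_) Metric.isClosed_cthickening).trans hδΩ
    by_contra hx'
    exact hx (hζ0 fun h' => hx' (Metric.thickening_subset_cthickening _ _ h'))
  set k : Eu d → ℝ := fun x => c x * ζ x with hk_def
  set w : Eu d → ℝ := fun x => c x * φ x with hw_def
  have hkc : Continuous k := (hc.mul ζ.continuous.continuousOn).continuous_of_tsupport_subset hΩ
    (tsupport_mul_subset_right.trans hζΩ)
  have hks : HasCompactSupport k := hζc.mul_left
  have hwsub : tsupport w ⊆ tsupport φ := tsupport_mul_subset_right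
  have hwc : Continuous w :=
    (hc.mul hφ.smooth.continuous.continuousOn).continuous_of_tsupport_subset hΩ
    (hwsub.trans hφ.support_subset)
  have hws : HasCompactSupport w := hφ.compact.mul_left
  have hζφ : ∀ x ∈ tsupport φ, ζ x = 1 := fun x hx =>
    hζ1 (Metric.self_subset_cthickening _ hx)
  -- Outer radii at most `δ / 2` keep the support of the mollified `w` where `ζ = 1`, and inside
  -- `Ω`.
  let ρ : ℕ → ContDiffBump (0 : Eu d) := fun n =>
    ⟨δ / 2 / (n + 2), δ / 2 / (n + 1), by positivity, by gcongr; linarith⟩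
  have hρ : Tendsto (fun n => (ρ n).rOut) atTop (𝓝 0) :=
    tendsto_const_nhds.div_atTop (tendsto_natCast_atTop_atTop.atTop_add tendsto_const_nhds)
  have hρle : ∀ n, (ρ n).rOut ≤ δ / 2 := fun n =>
    div_le_self (by positivity) (by linarith [n.cast_nonneg (α := ℝ)])
  have hcφ' : Integrable (fun x => c x * fderiv ℝ φ x e) (volume.restrict Ω) :=
    ((hφ.continuous_fderiv_apply e).integrable_of_hasCompactSupport
      (hφ.hasCompactSupport_fderiv_apply e)).restrict.bdd_mul hcm hcM
  have hGφ : Integrable (fun x => G x * φ x) (volume.restrict Ω) :=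
    integrable_mul_of_memLp_two h.1 hφ.memLp
  have identity : ∀ n, (∫ x in Ω, c x * fderiv ℝ φ x e * mollify (ρ n) k x)
      + ∫ x in Ω, G x * mollify (ρ n) w x = -∫ x in Ω, G x * φ x * mollify (ρ n) k x := by
    intro n
    have hK := contDiff_mollify (ρ n) hkc
    have hW := contDiff_mollify (ρ n) hwc
    have hKφ : IsTestFun Ω (fun x => mollify (ρ n) k x * φ x) :=
      ⟨hK.mul hφ.smooth, hφ.compact.mul_left, tsupport_mul_subset_right.trans hφ.support_subset⟩
    have hWsub : tsupport (mollify (ρ n) w) ⊆ Metric.cthickening (δ / 2) (tsupport φ) :=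
      (tsupport_mollify_subset (ρ n) w).trans
        ((Metric.cthickening_mono (hρle n) _).trans (Metric.cthickening_subset_of_subset _ hwsub))
    have hWtest : IsTestFun Ω (mollify (ρ n) w) :=
      ⟨hW, hφ.compact.isCompact.cthickening.of_isClosed_subset (isClosed_tsupport _) hWsub,
        hWsub.trans ((Metric.cthickening_mono (by linarith) _).trans hδΩ)⟩
    have hK' : Continuous fun x => fderiv ℝ (mollify (ρ n) k) x e :=
      (hK.continuous_fderiv (by simp)).clm_apply continuous_const
    have e1 : ∀ x, c x * fderiv ℝ (fun y => mollify (ρ n) k y * φ y) x e =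
        c x * fderiv ℝ φ x e * mollify (ρ n) k x + w x * fderiv ℝ (mollify (ρ n) k) x e := by
      intro x
      rw [fderiv_fun_mul (hK.differentiable (by simp) x) (hφ.smooth.differentiable (by simp) x)]
      simp only [add_apply, smul_apply, smul_eq_mul, hw_def]
      ring
    have i1 : Integrable (fun x => c x * fderiv ℝ φ x e * mollify (ρ n) k x)
        (volume.restrict Ω) := by
      have := ((((hφ.continuous_fderiv_apply e).mul hK.continuous).integrable_of_hasCompactSupport
        (hφ.hasCompactSupport_fderiv_apply e).mul_right).restrict (s := Ω)).bdd_mul hcm hcM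
      exact this.congr (Eventually.of_forall fun x => (mul_assoc _ _ _).symm)
    have i2 : Integrable (fun x => w x * fderiv ℝ (mollify (ρ n) k) x e)
        (volume.restrict Ω) :=
      ((hwc.mul hK').integrable_of_hasCompactSupport hws.mul_right).restrict
    have t1 : ∫ x in Ω, c x * fderiv ℝ (fun y => mollify (ρ n) k y * φ y) x e =
        -∫ x in Ω, G x * (mollify (ρ n) k x * φ x) := h.2 _ hKφ
    simp_rw [e1] at t1
    rw [integral_add i1 i2] at t1
    have t2 : ∫ x in Ω, w x * fderiv ℝ (mollify (ρ n) k) x e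
        = ∫ x in Ω, G x * mollify (ρ n) w x := by
      rw [setIntegral_eq_integral_of_forall_compl_eq_zero fun x hx => by
        rw [image_eq_zero_of_notMem_tsupport (fun h' => hx (hφ.support_subset (hwsub h'))),
          zero_mul],
        integral_mul_fderiv_mollify (ρ n) hkc hks hwc hws,
        ← setIntegral_eq_integral_of_forall_compl_eq_zero (s := Ω) fun x hx => by
          rw [hk_def]
          simp only
          rw [image_eq_zero_of_notMem_tsupport (fun h' => hx (hζΩ h')), mul_zero, zero_mul],
        neg_eq_iff_eq_neg, ← h.2 _ hWtest]
      refine integral_congr_ae (Eventually.of_forall fun x => ?_)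
      by_cases hx : x ∈ tsupport (mollify (ρ n) w)
      · simp [hk_def, hζ1 (hWsub hx), e]
      · have : fderiv ℝ (mollify (ρ n) w) x = 0 := by
          by_contra hne
          exact hx (support_fderiv_subset ℝ hne)
        simp [this]
    rw [t2] at t1
    rw [t1]
    congr 1
    exact integral_congr_ae (Eventually.of_forall fun x => by ring)
  have l1 := tendsto_integral_mul_mollify hρ hkc hks hcφ'
  have l2 := tendsto_integral_mul_mollify hρ hwc hws (h.1.integrable one_le_two)
  have l3 := (tendsto_integral_mul_mollify hρ hkc hks hGφ).neg
  have lim := tendsto_nhds_unique ((l1.add l2).congr identity) l3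
  have r1 : ∫ x in Ω, c x * fderiv ℝ φ x e * k x = ∫ x in Ω, c x ^ 2 * fderiv ℝ φ x e := by
    refine integral_congr_ae (Eventually.of_forall fun x => ?_)
    by_cases hx : x ∈ tsupport φ
    · simp only [hk_def, hζφ x hx]
      ring
    · have : fderiv ℝ φ x = 0 := by
        by_contra hne
        exact hx (support_fderiv_subset ℝ hne)
      simp [this]
  have r3 : ∫ x in Ω, G x * φ x * k x = ∫ x in Ω, G x * w x := by
    refine integral_congr_ae (Eventually.of_forall fun x => ?_)
    by_cases hx : x ∈ tsupport φ
    · simp only [hk_def, hw_def, hζφ x hx]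
      ring
    · simp [hw_def, image_eq_zero_of_notMem_tsupport hx]
  have r4 : ∫ x in Ω, 2 * (c x * G x) * φ x = 2 * ∫ x in Ω, G x * w x := by
    rw [← integral_const_mul]
    exact integral_congr_ae (Eventually.of_forall fun x => by simp only [hw_def]; ring)
  rw [r1, r3] at lim
  rw [r4]
  linarith
/-! ### The convective terms vanish on the diagonal -/

lemma exists_abs_le_of_continuousOn_closure (hΩb : Bornology.IsBounded Ω) {c : Eu d → ℝ}
    (hc : ContinuousOn c (closure Ω)) : ∃ M, ∀ x ∈ Ω, |c x| ≤ M := by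
  obtain ⟨M, hM⟩ := hΩb.isCompact_closure.exists_bound_of_continuousOn hc
  exact ⟨M, fun x hx => hM x (subset_closure hx)⟩

lemma memLp_mul_of_continuousOn_closure (hΩ : IsOpen Ω) (hΩb : Bornology.IsBounded Ω)
    {c G : Eu d → ℝ} (hc : ContinuousOn c (closure Ω)) (hG : MemL2 Ω G) :
    MemL2 Ω (fun x => c x * G x) := by
  obtain ⟨M, hM⟩ := exists_abs_le_of_continuousOn_closure hΩb hc
  refine MemLp.of_le_mul (c := M) hG
    (((hc.mono subset_closure).aestronglyMeasurable hΩ.measurableSet).mul hG.1) ?_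
  filter_upwards [ae_restrict_mem hΩ.measurableSet] with x hx
  rw [norm_mul]
  exact mul_le_mul_of_nonneg_right (hM x hx) (norm_nonneg _)

lemma integrable_mul_wd_mul (hΩ : IsOpen Ω) (hΩb : Bornology.IsBounded Ω) {w c : Eu d → ℝ}
    (hw : MemH1 Ω w) (hc : MemH1 Ω c) (hcc : ContinuousOn c (closure Ω)) (j : Fin d) :
    Integrable (fun x => w x * wd Ω j c x * c x) (volume.restrict Ω) := by
  refine (integrable_mul_of_memLp_two hw.1
    (memLp_mul_of_continuousOn_closure hΩ hΩb hcc (memLp_wd hc j))).congr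
    (Eventually.of_forall fun x => ?_)
  ring

lemma integrable_wd_mul_mul (hΩ : IsOpen Ω) (hΩb : Bornology.IsBounded Ω) {w c : Eu d → ℝ}
    (hw : MemH1 Ω w) (hc : MemH1 Ω c) (hcc : ContinuousOn c (closure Ω)) (j : Fin d) :
    Integrable (fun x => wd Ω j w x * c x * c x) (volume.restrict Ω) := by
  refine (integrable_mul_of_memLp_two (memLp_wd hw j)
    (memLp_mul_of_continuousOn_closure hΩ hΩb hcc hc.1)).congr
    (Eventually.of_forall fun x => ?_)
  ring

/-- `c ∂ⱼc` is half the weak derivative of `c²`, and `w ∈ H¹₀` removes the boundary term. -/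
lemma MemH10.integral_mul_wd_mul (hΩ : IsOpen Ω) (hΩb : Bornology.IsBounded Ω)
    {w c : Eu d → ℝ} (hw : MemH10 Ω w) (hc : MemH1 Ω c) (hcc : ContinuousOn c (closure Ω))
    (j : Fin d) :
    ∫ x in Ω, w x * wd Ω j c x * c x = -(1 / 2 * ∫ x in Ω, wd Ω j w x * c x * c x) := by
  obtain ⟨M, hM⟩ := exists_abs_le_of_continuousOn_closure hΩb hcc
  have hsq := (isWeakDeriv_wd hc j).sq hΩ hΩb (hcc.mono subset_closure) hM
  have hc2 : MemL2 Ω (fun x => c x ^ 2) := by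
    simpa only [pow_two] using memLp_mul_of_continuousOn_closure hΩ hΩb hcc hc.1
  have key := hw.integral_mul_eq_neg hc2 hsq
  have e1 : ∫ x in Ω, w x * (2 * (c x * wd Ω j c x)) = 2 * ∫ x in Ω, w x * wd Ω j c x * c x := by
    rw [← integral_const_mul]
    exact integral_congr_ae (Eventually.of_forall fun x => by ring)
  have e2 : ∫ x in Ω, wd Ω j w x * c x ^ 2 = ∫ x in Ω, wd Ω j w x * c x * c x :=
    integral_congr_ae (Eventually.of_forall fun x => by ring)
  rw [e1, e2] at key
  linarith

lemma integrable_convection (hΩ : IsOpen Ω) (hΩb : Bornology.IsBounded Ω)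
    {u : Eu d → Eu d} {c : Eu d → ℝ} (hu : MemV Ω u) (hc : MemH1 Ω c)
    (hcc : ContinuousOn c (closure Ω)) :
    Integrable (fun x => (∑ j, u x j * wd Ω j c x) * c x) (volume.restrict Ω) := by
  simp_rw [Finset.sum_mul]
  exact integrable_finsetSum _ fun j _ => integrable_mul_wd_mul hΩ hΩb (hu j).1 hc hcc j

lemma integrable_wdiv_mul_mul (hΩ : IsOpen Ω) (hΩb : Bornology.IsBounded Ω)
    {u : Eu d → Eu d} {c : Eu d → ℝ} (hu : MemV Ω u) (hc : MemH1 Ω c)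
    (hcc : ContinuousOn c (closure Ω)) :
    Integrable (fun x => wdiv Ω u x * c x * c x) (volume.restrict Ω) := by
  simp_rw [wdiv, Finset.sum_mul]
  exact integrable_finsetSum _ fun j _ => integrable_wd_mul_mul hΩ hΩb (hu j).1 hc hcc j

/-- The half-divergence term compensates, coordinate by coordinate, what integration by parts
leaves. Pointwise incompressibility of `u`, which the discrete velocity need not have, is therefore
not required. -/
lemma formb_self (hΩ : IsOpen Ω) (hΩb : Bornology.IsBounded Ω) {u : Eu d → Eu d} {c : Eu d → ℝ}
    (hu : MemV Ω u) (hc : MemH1 Ω c) (hcc : ContinuousOn c (closure Ω)) :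
    formb Ω u c c = 0 := by
  simp_rw [formb, wdiv, Finset.sum_mul]
  rw [integral_finsetSum _ fun j _ => integrable_mul_wd_mul hΩ hΩb (hu j).1 hc hcc j,
    integral_finsetSum _ fun j _ => integrable_wd_mul_mul hΩ hΩb (hu j).1 hc hcc j,
    Finset.mul_sum, ← Finset.sum_add_distrib]
  refine Finset.sum_eq_zero fun j _ => ?_
  rw [(hu j).integral_mul_wd_mul hΩ hΩb hc hcc j]
  ring

lemma formB_self (hΩ : IsOpen Ω) (hΩb : Bornology.IsBounded Ω) {u v : Eu d → Eu d}
    (hu : MemV Ω u) (hv : MemV Ω v) (hvc : ContinuousOn v (closure Ω)) :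
    formB Ω u v v = 0 := by
  have hvi : ∀ i, ContinuousOn (fun x => v x i) (closure Ω) := fun i =>
    (EuclideanSpace.proj (𝕜 := ℝ) i).continuous.comp_continuousOn hvc
  have h : formB Ω u v v = ∑ i, formb Ω u (fun x => v x i) (fun x => v x i) := by
    have e : ∀ x, wdiv Ω u x * inner ℝ (v x) (v x) = ∑ i, wdiv Ω u x * v x i * v x i := by
      intro x
      rw [PiLp.inner_apply, Finset.mul_sum]
      refine Finset.sum_congr rfl fun i _ => ?_
      simp only [RCLike.inner_apply, conj_trivial]
      ring
    simp_rw [formB, formb, e]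
    rw [integral_finsetSum _ fun i _ => integrable_convection hΩ hΩb hu (hv i).1 (hvi i),
      integral_finsetSum _ fun i _ => integrable_wdiv_mul_mul hΩ hΩb hu (hv i).1 (hvi i),
      Finset.mul_sum, ← Finset.sum_add_distrib]
  rw [h]
  exact Finset.sum_eq_zero fun i _ => formb_self hΩ hΩb hu (hv i).1 (hvi i)

/-! ### The Poincaré inequality -/

/-- Write `1 = ∂ᵢ xᵢ` and integrate by parts: `∫ φ² = -∫ 2 xᵢ φ ∂ᵢφ`. Young's inequality with `|xᵢ|
≤ R` gives `½ ∫ φ² + 2 R² ∫ (∂ᵢφ)²`, and the first term is absorbed. -/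
lemma IsTestFun.integral_sq_le {φ : Eu d → ℝ} (hφ : IsTestFun Ω φ) {R : ℝ}
    (hR : ∀ x ∈ Ω, ‖x‖ ≤ R) (hΩ : IsOpen Ω) (i : Fin d) :
    ∫ x in Ω, φ x ^ 2 ≤ 4 * R ^ 2 * ∫ x in Ω, fderiv ℝ φ x (unitVec i) ^ 2 := by
  have hc := hφ.smooth.continuous
  have hc' := hφ.continuous_fderiv_apply (unitVec i)
  have hs' := hφ.hasCompactSupport_fderiv_apply (unitVec i)
  have hx : Continuous fun x : Eu d => x i := (EuclideanSpace.proj (𝕜 := ℝ) i).continuous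
  have hfd : ∀ x, fderiv ℝ (fun x : Eu d => x i) x (unitVec i) = 1 := by
    intro x
    have : HasFDerivAt (fun x : Eu d => x i) (EuclideanSpace.proj (𝕜 := ℝ) i) x :=
      (EuclideanSpace.proj (𝕜 := ℝ) i).hasFDerivAt
    rw [this.fderiv]
    simp [unitVec]
  have hdφ : ∀ x, DifferentiableAt ℝ φ x := fun x => hφ.smooth.differentiable (by simp) x
  have hfd2 : ∀ x, fderiv ℝ (fun x => φ x ^ 2) x (unitVec i)
      = 2 * φ x * fderiv ℝ φ x (unitVec i) := by
    intro x
    rw [fderiv_fun_pow 2 (hdφ x)]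
    simp
  have hs2 : HasCompactSupport fun x => φ x ^ 2 :=
    HasCompactSupport.intro hφ.compact.isCompact fun x hx => by
      rw [image_eq_zero_of_notMem_tsupport hx, zero_pow two_ne_zero]
  have hs2' : HasCompactSupport fun x => fderiv ℝ φ x (unitVec i) ^ 2 :=
    HasCompactSupport.intro hs'.isCompact fun x hx => by
      have := image_eq_zero_of_notMem_tsupport hx
      rw [this, zero_pow two_ne_zero]
  have i0 : Integrable (fun x => φ x ^ 2) volume :=
    (hc.pow 2).integrable_of_hasCompactSupport hs2
  have i1 : Integrable (fun x => x i * (2 * φ x * fderiv ℝ φ x (unitVec i))) volume :=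
    (hx.mul ((continuous_const.mul hc).mul hc')).integrable_of_hasCompactSupport
      (hs'.mul_left.mul_left)
  have i2 : Integrable (fun x => fderiv ℝ φ x (unitVec i) ^ 2) volume :=
    (hc'.pow 2).integrable_of_hasCompactSupport hs2'
  have i3 : Integrable (fun x : Eu d => x i * φ x ^ 2) volume :=
    (hx.mul (hc.pow 2)).integrable_of_hasCompactSupport
      hs2.mul_left
  have parts := integral_mul_fderiv_eq_neg_fderiv_mul_of_integrable (μ := volume)
    (f := fun x : Eu d => x i) (g := fun x => φ x ^ 2) (v := unitVec i)
    (by simpa only [hfd, one_mul] using i0) (by simpa only [hfd2] using i1) i3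
    (fun x _ => (EuclideanSpace.proj (𝕜 := ℝ) i).differentiableAt) (fun x _ => (hdφ x).pow 2)
  simp only [hfd, hfd2, one_mul] at parts
  have s0 : ∫ x in Ω, φ x ^ 2 = ∫ x, φ x ^ 2 :=
    setIntegral_eq_integral_of_forall_compl_eq_zero fun x hx => by
      rw [image_eq_zero_of_notMem_tsupport (fun h' => hx (hφ.support_subset h'))]; ring
  have s1 : ∫ x in Ω, x i * (2 * φ x * fderiv ℝ φ x (unitVec i))
      = ∫ x, x i * (2 * φ x * fderiv ℝ φ x (unitVec i)) :=
    setIntegral_eq_integral_of_forall_compl_eq_zero fun x hx => by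
      rw [image_eq_zero_of_notMem_tsupport (fun h' => hx (hφ.support_subset h'))]; ring
  rw [← s0, ← s1] at parts
  have bound : -∫ x in Ω, x i * (2 * φ x * fderiv ℝ φ x (unitVec i)) ≤
      ∫ x in Ω, (1 / 2 * φ x ^ 2 + 2 * R ^ 2 * fderiv ℝ φ x (unitVec i) ^ 2) := by
    rw [← integral_neg]
    refine setIntegral_mono_on i1.restrict.neg
      ((i0.restrict.const_mul _).add (i2.restrict.const_mul _)) hΩ.measurableSet fun x hx => ?_
    have hxi : (x i) ^ 2 ≤ R ^ 2 := by
      rw [← sq_abs]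
      exact pow_le_pow_left₀ (abs_nonneg _) ((PiLp.norm_apply_le x i).trans (hR x hx)) 2
    nlinarith [sq_nonneg (φ x + 2 * x i * fderiv ℝ φ x (unitVec i)),
      mul_le_mul_of_nonneg_right hxi (sq_nonneg (fderiv ℝ φ x (unitVec i)))]
  rw [integral_add (i0.restrict.const_mul _) (i2.restrict.const_mul _), integral_const_mul,
    integral_const_mul] at bound
  linarith

/-- By density. The inequality `f² ≤ 2 (f - g)² + 2 g²` is used for the function and for its
derivative, which turns the factor 4 into 16. -/
lemma MemH10.integral_sq_le {v : Eu d → ℝ} (hv : MemH10 Ω v) {R : ℝ}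
    (hR : ∀ x ∈ Ω, ‖x‖ ≤ R) (hΩ : IsOpen Ω) (i : Fin d) :
    ∫ x in Ω, v x ^ 2 ≤ 16 * R ^ 2 * ∫ x in Ω, wd Ω i v x ^ 2 := by
  obtain ⟨hv1, φ, hφ, hφ0, hφ1⟩ := hv
  have lim : Tendsto (fun k => 2 * (∫ x in Ω, (φ k x - v x) ^ 2) + 8 * R ^ 2 *
      (2 * (∫ x in Ω, (fderiv ℝ (φ k) x (unitVec i) - wd Ω i v x) ^ 2)
        + 2 * ∫ x in Ω, wd Ω i v x ^ 2)) atTop (𝓝 (16 * R ^ 2 * ∫ x in Ω, wd Ω i v x ^ 2)) := by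
    convert (hφ0.const_mul 2).add ((((hφ1 i).const_mul 2).add_const
      (2 * ∫ x in Ω, wd Ω i v x ^ 2)).const_mul (8 * R ^ 2)) using 2
    ring
  have split : ∀ f g : Eu d → ℝ, MemLp f 2 (volume.restrict Ω) → MemLp g 2 (volume.restrict Ω) →
      ∫ x in Ω, f x ^ 2 ≤ 2 * (∫ x in Ω, (f x - g x) ^ 2) + 2 * ∫ x in Ω, g x ^ 2 := by
    intro f g hf hg
    have i1 : Integrable (fun x => (f x - g x) ^ 2) (volume.restrict Ω) :=
      (hf.sub hg).integrable_sq
    rw [← integral_const_mul, ← integral_const_mul,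
      ← integral_add (i1.const_mul _) (hg.integrable_sq.const_mul _)]
    refine integral_mono hf.integrable_sq ((i1.const_mul _).add (hg.integrable_sq.const_mul _))
      fun x => ?_
    simp only
    nlinarith [sq_nonneg (f x - 2 * g x)]
  refine ge_of_tendsto lim (Eventually.of_forall fun k => ?_)
  have h1 := split v (φ k) hv1.1 (hφ k).memLp
  have h2 := split (fun x => fderiv ℝ (φ k) x (unitVec i)) (wd Ω i v)
    ((hφ k).memLp_fderiv_apply _) (memLp_wd hv1 i)
  have h3 := (hφ k).integral_sq_le hR hΩ i
  have h4 : ∫ x in Ω, (v x - φ k x) ^ 2 = ∫ x in Ω, (φ k x - v x) ^ 2 :=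
    integral_congr_ae (Eventually.of_forall fun x => by ring)
  have h5 := mul_le_mul_of_nonneg_left h2 (by positivity : 0 ≤ 8 * R ^ 2)
  rw [h4] at h1
  linarith

lemma l2Sq_eq_sum {v : Eu d → Eu d} (hv : ∀ i, MemL2 Ω (fun x => v x i)) :
    l2Sq Ω v = ∑ i, ∫ x in Ω, v x i ^ 2 := by
  rw [l2Sq, ← integral_finsetSum _ fun i _ => (hv i).integrable_sq]
  refine integral_congr_ae (Eventually.of_forall fun x => ?_)
  simp only [EuclideanSpace.norm_sq_eq, Real.norm_eq_abs, sq_abs]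

lemma gradSq_nonneg (r : Eu d → ℝ) : 0 ≤ gradSq Ω r :=
  Finset.sum_nonneg fun _ _ => integral_nonneg fun _ => sq_nonneg _

lemma vgradSq_nonneg (v : Eu d → Eu d) : 0 ≤ vgradSq Ω v :=
  Finset.sum_nonneg fun _ _ => gradSq_nonneg _

lemma l2Sq_nonneg {F : Type*} [NormedAddCommGroup F] (v : Eu d → F) : 0 ≤ l2Sq Ω v :=
  integral_nonneg fun _ => sq_nonneg _

lemma integral_wd_sq_le_gradSq (r : Eu d → ℝ) (i : Fin d) :
    ∫ x in Ω, wd Ω i r x ^ 2 ≤ gradSq Ω r :=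
  Finset.single_le_sum (f := fun j => ∫ x in Ω, wd Ω j r x ^ 2)
    (fun _ _ => integral_nonneg fun _ => sq_nonneg _) (Finset.mem_univ i)

/-- The Poincaré inequality for vector fields. -/
lemma MemV.l2Sq_le {v : Eu d → Eu d} (hv : MemV Ω v) {R : ℝ} (hR : ∀ x ∈ Ω, ‖x‖ ≤ R)
    (hΩ : IsOpen Ω) : l2Sq Ω v ≤ 16 * R ^ 2 * vgradSq Ω v := by
  rw [l2Sq_eq_sum fun i => (hv i).1.1, vgradSq, Finset.mul_sum]
  refine Finset.sum_le_sum fun i _ => ((hv i).integral_sq_le hR hΩ i).trans ?_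
  exact mul_le_mul_of_nonneg_left (integral_wd_sq_le_gradSq _ i) (by positivity)

/-! ### The finite element spaces are closed under averages -/

lemma IsP1On.average {s : Finset (Eu d)} {v w : Eu d → ℝ} (hv : IsP1On s v) (hw : IsP1On s w) :
    IsP1On s (fun x => 2⁻¹ * v x + 2⁻¹ * w x) := by
  obtain ⟨l, hl⟩ := hv
  obtain ⟨l', hl'⟩ := hw
  refine ⟨(2⁻¹ : ℝ) • l + (2⁻¹ : ℝ) • l', fun x hx => ?_⟩
  simp [hl x hx, hl' x hx]

lemma IsP1bOn.average {s : Finset (Eu d)} {v w : Eu d → ℝ} (hv : IsP1bOn s v)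
    (hw : IsP1bOn s w) : IsP1bOn s (fun x => 2⁻¹ * v x + 2⁻¹ * w x) := by
  obtain ⟨l, k, hl⟩ := hv
  obtain ⟨l', k', hl'⟩ := hw
  refine ⟨(2⁻¹ : ℝ) • l + (2⁻¹ : ℝ) • l', 2⁻¹ * k + 2⁻¹ * k', fun x hx => ?_⟩
  simp only [hl x hx, hl' x hx, AffineMap.coe_add, AffineMap.coe_smul, Pi.add_apply,
    Pi.smul_apply, smul_eq_mul]
  ring

lemma average_apply (v w : Eu d → Eu d) (i : Fin d) :
    (fun x => ((2 : ℝ)⁻¹ • (v x + w x)) i) = fun x => 2⁻¹ * v x i + 2⁻¹ * w x i := by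
  funext x
  simp only [PiLp.smul_apply, PiLp.add_apply, smul_eq_mul]
  ring

lemma average_eq (v w : Eu d → ℝ) :
    (fun x => (v x + w x) / 2) = fun x => 2⁻¹ * v x + 2⁻¹ * w x := by
  funext x
  ring

variable {K : Geometry.SimplicialComplex ℝ (Eu d)}

lemma MemVh.average (hΩ : IsOpen Ω) {v w : Eu d → Eu d} (hv : MemVh Ω K v) (hw : MemVh Ω K w) :
    MemVh Ω K (fun x => (2 : ℝ)⁻¹ • (v x + w x)) where
  cont := by
    have h1 := hv.cont
    have h2 := hw.cont
    fun_prop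
  memV i := by
    rw [average_apply]
    exact (hv.memV i).linComb hΩ (hw.memV i) _ _
  poly s hs i := by
    rw [average_apply]
    exact (hv.poly s hs i).average (hw.poly s hs i)

lemma MemHth.average (hΩb : Bornology.IsBounded Ω) {v w : Eu d → ℝ} (hv : MemHth Ω K v)
    (hw : MemHth Ω K w) : MemHth Ω K (fun x => (v x + w x) / 2) := by
  have : IsFiniteMeasure (volume.restrict Ω) :=
    isFiniteMeasure_restrict.2 hΩb.measure_lt_top.ne
  have i1 : Integrable v (volume.restrict Ω) := hv.memHt.1.1.integrable one_le_two
  have i2 : Integrable w (volume.restrict Ω) := hw.memHt.1.1.integrable one_le_two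
  have hH1 := hv.memHt.1.linComb hw.memHt.1 2⁻¹ 2⁻¹
  rw [average_eq]
  refine ⟨(hv.cont.const_mul _).add (hw.cont.const_mul _), ⟨hH1, hH1.1, ?_⟩,
    fun s hs => (hv.poly s hs).average (hw.poly s hs)⟩
  rw [integral_add (i1.const_mul _) (i2.const_mul _), integral_const_mul, integral_const_mul,
    hv.memHt.2.2, hw.memHt.2.2]
  simp

/-- Passes from the average, which is the test function, to the sum that appears in the stability
estimate. -/
lemma gradSq_add (hΩ : IsOpen Ω) {v w : Eu d → ℝ} (hv : MemH1 Ω v) (hw : MemH1 Ω w) :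
    gradSq Ω (fun x => v x + w x) = 4 * gradSq Ω (fun x => 2⁻¹ * v x + 2⁻¹ * w x) := by
  have e : (fun x => v x + w x) = fun x => 1 * v x + 1 * w x := by simp
  rw [e, gradSq, gradSq, Finset.mul_sum]
  refine Finset.sum_congr rfl fun j _ => ?_
  rw [← integral_const_mul]
  refine integral_congr_ae ?_
  filter_upwards [wd_linComb hΩ hv hw 1 1 j, wd_linComb hΩ hv hw 2⁻¹ 2⁻¹ j] with x h1 h2
  rw [h1, h2]
  ring

lemma vgradSq_add (hΩ : IsOpen Ω) {v w : Eu d → Eu d} (hv : MemV Ω v) (hw : MemV Ω w) :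
    vgradSq Ω (fun x => v x + w x) = 4 * vgradSq Ω (fun x => (2 : ℝ)⁻¹ • (v x + w x)) := by
  rw [vgradSq, vgradSq, Finset.mul_sum]
  refine Finset.sum_congr rfl fun i _ => ?_
  rw [average_apply]
  exact gradSq_add hΩ (hv i).1 (hw i).1

/-! ### Square integrability of vector fields -/

lemma MemV.memLp {v : Eu d → Eu d} (hv : MemV Ω v) : MemLp v 2 (volume.restrict Ω) :=
  MemLp.of_eval_piLp fun i => (hv i).1.1

lemma integrable_norm_sq {F : Type*} [NormedAddCommGroup F] {v : Eu d → F}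
    (hv : MemL2 Ω v) : Integrable (fun x => ‖v x‖ ^ 2) (volume.restrict Ω) :=
  MemLp.integrable_norm_pow (p := 2) (by exact_mod_cast hv) two_ne_zero

lemma integrable_inner {v w : Eu d → Eu d} (hv : MemL2 Ω v) (hw : MemL2 Ω w) :
    Integrable (fun x => inner ℝ (v x) (w x)) (volume.restrict Ω) := by
  refine ((integrable_norm_sq hv).add (integrable_norm_sq hw)).mono' (hv.1.inner hw.1)
    (Eventually.of_forall fun x => (abs_real_inner_le_norm _ _).trans ?_)
  simp only [Pi.add_apply]
  nlinarith [sq_nonneg (‖v x‖ - ‖w x‖), sq_nonneg ‖v x‖, sq_nonneg ‖w x‖]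

/-! ### Energy estimates for one time step -/

/-- Coercivity of the viscous form. -/
lemma le_formA_self {κ β α : ℝ} {ν : ℝ → ℝ} (hν : ViscosityAssumption κ β ν) {c : Eu d → ℝ}
    (hc : MemL2 Ω c) {v : Eu d → Eu d} (hv : MemV Ω v) :
    κ * vgradSq Ω v ≤ formA Ω ν α c v v := by
  have hνc : Continuous ν := (LipschitzWith.of_dist_le' (K := β) fun x y => by
    rw [Real.dist_eq, Real.dist_eq]; exact hν.lipschitz x y).continuous
  have i1 : ∀ i j, Integrable (fun x => wd Ω j (fun y => v y i) x ^ 2) (volume.restrict Ω) :=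
    fun i j => (memLp_wd (hv i).1 j).integrable_sq
  have i2 : Integrable (fun x => ∑ i, ∑ j, wd Ω j (fun y => v y i) x ^ 2) (volume.restrict Ω) :=
    integrable_finsetSum _ fun i _ => integrable_finsetSum _ fun j _ => i1 i j
  have i3 : Integrable (fun x => ν (c x + α) * ∑ i, ∑ j, wd Ω j (fun y => v y i) x ^ 2)
      (volume.restrict Ω) := by
    -- The two-sided bound on `ν` serves only integrability here; coercivity comes from the lower
    -- bound.
    refine i2.bdd_mul (c := |κ| + |κ⁻¹|)
      (hνc.comp_aestronglyMeasurable (hc.1.add_const α)) (Eventually.of_forall fun x => ?_)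
    rw [Real.norm_eq_abs, abs_le]
    have h1 := hν.lower (c x + α)
    have h2 := hν.upper (c x + α)
    constructor <;> linarith [neg_abs_le κ, le_abs_self κ⁻¹, abs_nonneg κ, abs_nonneg κ⁻¹]
  have e : vgradSq Ω v = ∫ x in Ω, ∑ i, ∑ j, wd Ω j (fun y => v y i) x ^ 2 := by
    rw [integral_finsetSum _ fun i _ => integrable_finsetSum _ fun j _ => i1 i j]
    refine Finset.sum_congr rfl fun i _ => ?_
    rw [integral_finsetSum _ fun j _ => i1 i j]
    rfl
  simp_rw [formA, ← pow_two]
  rw [e, ← integral_const_mul]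
  refine integral_mono (i2.const_mul κ) i3 fun x => ?_
  exact mul_le_mul_of_nonneg_right (hν.lower _)
    (Finset.sum_nonneg fun i _ => Finset.sum_nonneg fun j _ => sq_nonneg _)

/-- `(v - w) · (v + w) = |v|² - |w|²`: the leapfrog difference against the Crank–Nicolson average.
-/
lemma integral_inner_sub_average {v w : Eu d → Eu d} (hv : MemL2 Ω v) (hw : MemL2 Ω w) (τ : ℝ) :
    ∫ x in Ω, inner ℝ ((2 * τ)⁻¹ • (v x - w x)) ((2 : ℝ)⁻¹ • (v x + w x))
      = (4 * τ)⁻¹ * (l2Sq Ω v - l2Sq Ω w) := by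
  rw [l2Sq, l2Sq, ← integral_sub (integrable_norm_sq hv) (integrable_norm_sq hw),
    ← integral_const_mul]
  refine integral_congr_ae (Eventually.of_forall fun x => ?_)
  simp only [real_inner_smul_left, real_inner_smul_right, inner_sub_left, inner_add_right,
    real_inner_self_eq_norm_sq, real_inner_comm (v x) (w x), mul_inv]
  ring

lemma integral_sub_mul_average {v w : Eu d → ℝ} (hv : MemL2 Ω v) (hw : MemL2 Ω w) (τ : ℝ) :
    ∫ x in Ω, (v x - w x) / (2 * τ) * ((v x + w x) / 2)
      = (4 * τ)⁻¹ * (l2Sq Ω v - l2Sq Ω w) := by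
  rw [l2Sq, l2Sq, ← integral_sub (integrable_norm_sq hv) (integrable_norm_sq hw),
    ← integral_const_mul]
  refine integral_congr_ae (Eventually.of_forall fun x => ?_)
  simp only [Real.norm_eq_abs, sq_abs, mul_inv, div_eq_mul_inv]
  ring

/-- Bound of the forcing terms of the momentum equation. -/
lemma forcing_le (hΩb : Bornology.IsBounded Ω) {c : Eu d → ℝ} {f v : Eu d → Eu d}
    (hc : MemL2 Ω c) (hf : MemL2 Ω f) (hv : MemL2 Ω v) (e : Fin d) (g γ : ℝ) {δ : ℝ}
    (hδ : 0 < δ) :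
    -(∫ x in Ω, inner ℝ ((g * (1 + γ * c x)) • unitVec e) (v x)) + ∫ x in Ω, inner ℝ (f x) (v x)
      ≤ δ * l2Sq Ω v + (4 * δ)⁻¹ * (2 * l2Sq Ω f
        + 4 * g ^ 2 * (volume.real Ω + γ ^ 2 * l2Sq Ω c)) := by
  have : IsFiniteMeasure (volume.restrict Ω) :=
    isFiniteMeasure_restrict.2 hΩb.measure_lt_top.ne
  have hg : MemLp (fun x => g * (1 + γ * c x)) 2 (volume.restrict Ω) :=
    ((memLp_const (1 : ℝ)).add (hc.const_mul γ)).const_mul g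
  have hs : MemL2 Ω (fun x => (g * (1 + γ * c x)) • (unitVec e : Eu d)) :=
    (ContinuousLinearMap.toSpanSingleton ℝ (unitVec e : Eu d)).comp_memLp' hg
  have i1 : Integrable (fun x => -inner ℝ ((g * (1 + γ * c x)) • (unitVec e : Eu d)) (v x))
      (volume.restrict Ω) := (integrable_inner hs hv).neg
  have i2 := integrable_inner hf hv
  have j0 : Integrable (fun _ => (1 : ℝ)) (volume.restrict Ω) := integrable_const 1
  have j1 := integrable_norm_sq hv
  have j2 := integrable_norm_sq hf
  have j3 := integrable_norm_sq hc
  have e0 : volume.real Ω = ∫ x in Ω, (1 : ℝ) := by simp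
  have k1 : Integrable (fun x => 1 + γ ^ 2 * ‖c x‖ ^ 2) (volume.restrict Ω) :=
    j0.add (j3.const_mul _)
  have k2 : Integrable (fun x => 2 * ‖f x‖ ^ 2 + 4 * g ^ 2 * (1 + γ ^ 2 * ‖c x‖ ^ 2))
      (volume.restrict Ω) := (j2.const_mul _).add (k1.const_mul _)
  -- Each side is collected into a single integral, so that a pointwise estimate suffices.
  rw [← integral_neg, ← integral_add i1 i2, l2Sq, l2Sq, l2Sq, e0, ← integral_const_mul (γ ^ 2),
    ← integral_add j0 (j3.const_mul _), ← integral_const_mul (4 * g ^ 2), ← integral_const_mul 2,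
    ← integral_add (j2.const_mul _) (k1.const_mul _), ← integral_const_mul (4 * δ)⁻¹,
    ← integral_const_mul δ, ← integral_add (j1.const_mul _) (k2.const_mul _)]
  refine integral_mono (i1.add i2) ((j1.const_mul _).add (k2.const_mul _)) fun x => ?_
  simp only
  set s := g * (1 + γ * c x) with hs_def
  have hunit : ‖(unitVec e : Eu d)‖ = 1 := by simp [unitVec]
  have h1 : -inner ℝ (s • (unitVec e : Eu d)) (v x) + inner ℝ (f x) (v x)
      ≤ (|s| + ‖f x‖) * ‖v x‖ := by
    have a1 := abs_le.1 (abs_real_inner_le_norm (s • (unitVec e : Eu d)) (v x))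
    have a2 := abs_le.1 (abs_real_inner_le_norm (f x) (v x))
    rw [norm_smul, hunit, mul_one, Real.norm_eq_abs] at a1
    linarith [a1.1, a2.2]
  have h2 : (|s| + ‖f x‖) * ‖v x‖ ≤ δ * ‖v x‖ ^ 2 + (4 * δ)⁻¹ * (|s| + ‖f x‖) ^ 2 := by
    have : 0 ≤ δ * (‖v x‖ - (2 * δ)⁻¹ * (|s| + ‖f x‖)) ^ 2 := by positivity
    have h3 : δ * (‖v x‖ - (2 * δ)⁻¹ * (|s| + ‖f x‖)) ^ 2 = δ * ‖v x‖ ^ 2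
        + (4 * δ)⁻¹ * (|s| + ‖f x‖) ^ 2 - (|s| + ‖f x‖) * ‖v x‖ := by
      field_simp
      ring
    linarith
  have h3 : (|s| + ‖f x‖) ^ 2 ≤ 2 * ‖f x‖ ^ 2 + 4 * g ^ 2 * (1 + γ ^ 2 * ‖c x‖ ^ 2) := by
    have hs2 : s ^ 2 ≤ 2 * g ^ 2 * (1 + γ ^ 2 * c x ^ 2) := by
      rw [hs_def]
      nlinarith [mul_nonneg (sq_nonneg g) (sq_nonneg (1 - γ * c x))]
    rw [Real.norm_eq_abs (c x), sq_abs]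
    nlinarith [sq_nonneg (|s| - ‖f x‖), sq_abs s]
  have h4 := mul_le_mul_of_nonneg_left h3 (by positivity : 0 ≤ (4 * δ)⁻¹)
  linarith

/-- Bound of the upward swimming terms. -/
lemma swimming_le (hΩb : Bornology.IsBounded Ω) {c r : Eu d → ℝ}
    (hc : MemL2 Ω c) (hr : MemH1 Ω r) (e : Fin d) (U α : ℝ) {θ : ℝ} (hθ : 0 < θ) :
    U * (∫ x in Ω, c x * wd Ω e r x) + U * α * ∫ x in Ω, wd Ω e r x
      ≤ θ / 2 * gradSq Ω r + U ^ 2 / θ * (l2Sq Ω c + α ^ 2 * volume.real Ω) := by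
  have : IsFiniteMeasure (volume.restrict Ω) :=
    isFiniteMeasure_restrict.2 hΩb.measure_lt_top.ne
  have hw := memLp_wd hr e
  have i1 := integrable_mul_of_memLp_two hc hw
  have i2 : Integrable (wd Ω e r) (volume.restrict Ω) := hw.integrable one_le_two
  have j0 : Integrable (fun _ => (1 : ℝ)) (volume.restrict Ω) := integrable_const 1
  have j1 := hw.integrable_sq
  have j3 := integrable_norm_sq hc
  have e0 : volume.real Ω = ∫ x in Ω, (1 : ℝ) := by simp
  have main : U * (∫ x in Ω, c x * wd Ω e r x) + U * α * ∫ x in Ω, wd Ω e r x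
      ≤ θ / 2 * (∫ x in Ω, wd Ω e r x ^ 2)
        + U ^ 2 / θ * (l2Sq Ω c + α ^ 2 * volume.real Ω) := by
    have k1 : Integrable (fun x => ‖c x‖ ^ 2 + α ^ 2 * 1) (volume.restrict Ω) :=
      j3.add (j0.const_mul _)
    rw [l2Sq, e0, ← integral_const_mul U, ← integral_const_mul (U * α),
      ← integral_add (i1.const_mul _) (i2.const_mul _), ← integral_const_mul (α ^ 2),
      ← integral_add j3 (j0.const_mul _), ← integral_const_mul (U ^ 2 / θ),
      ← integral_const_mul (θ / 2), ← integral_add (j1.const_mul _) (k1.const_mul _)]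
    refine integral_mono ((i1.const_mul _).add (i2.const_mul _)) ((j1.const_mul _).add
      (k1.const_mul _)) fun x => ?_
    simp only [Real.norm_eq_abs, sq_abs]
    -- Completed square; the weight `θ / 2` costs only half of the diffusion.
    have h1 : 0 ≤ θ / 2 * (wd Ω e r x - U / θ * (c x + α)) ^ 2 := by positivity
    have h2 : θ / 2 * (wd Ω e r x - U / θ * (c x + α)) ^ 2 = θ / 2 * wd Ω e r x ^ 2
        - (U * (c x * wd Ω e r x) + U * α * wd Ω e r x) + U ^ 2 / θ * ((c x + α) ^ 2 / 2) := by
      field_simp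
      ring
    have h3 : U ^ 2 / θ * ((c x + α) ^ 2 / 2) ≤ U ^ 2 / θ * (c x ^ 2 + α ^ 2 * 1) := by
      refine mul_le_mul_of_nonneg_left ?_ (by positivity)
      nlinarith [sq_nonneg (c x - α)]
    linarith
  refine main.trans ?_
  have := mul_le_mul_of_nonneg_left (integral_wd_sq_le_gradSq (Ω := Ω) r e)
    (by positivity : 0 ≤ θ / 2)
  linarith

variable {e : Fin d} {ν : ℝ → ℝ} {κ β α g γ θ U τ : ℝ} {N : ℕ} {f u : ℕ → Eu d → Eu d}
  {p c : ℕ → Eu d → ℝ}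

/-- Energy estimate of the velocity for one time step. -/
lemma IsCNLFSolution.velocity_step (hΩ : IsOpen Ω) (hΩb : Bornology.IsBounded Ω)
    (hsol : IsCNLFSolution Ω K e ν α g γ θ U τ N f u p c) (hν : ViscosityAssumption κ β ν)
    (hκ : 0 < κ) (hτ : 0 < τ) {R : ℝ} (hR : ∀ x ∈ Ω, ‖x‖ ≤ R) {n : ℕ} (hn : 1 ≤ n)
    (hnN : n + 1 ≤ N) (hf : MemL2 Ω (f n)) :
    l2Sq Ω (u (n + 1)) - l2Sq Ω (u (n - 1))
        + κ / 2 * τ * vgradSq Ω (fun x => u (n + 1) x + u (n - 1) x)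
      ≤ 2 * (16 * R ^ 2 + 1) / κ * τ * (2 * l2Sq Ω (f n)
        + 4 * g ^ 2 * (volume.real Ω + γ ^ 2 * l2Sq Ω (c n))) := by
  have h1 := hsol.memu (n + 1) hnN
  have h2 := hsol.memu (n - 1) (by omega)
  have h0 := hsol.memu n (by omega)
  have hc := (hsol.memc n (by omega)).memHt.1.1
  have hav := h1.average hΩ h2
  have eq := hsol.momentum n hn hnN _ hav
  have hdiv := hsol.incompressible n hn hnN _ (hsol.memp n hn (by omega))
  have hA := le_formA_self (α := α) hν hc hav.memV
  -- Chosen so that `δ * (16 * R ^ 2 + 1) = κ / 2`: after Poincaré the forcing uses half of the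
  -- viscous dissipation. The `+ 1` keeps the denominator positive when `R = 0`.
  have hδ : 0 < κ / (2 * (16 * R ^ 2 + 1)) := by positivity
  have hF := forcing_le hΩb hc hf hav.memV.memLp e g γ hδ
  have hP := hav.memV.l2Sq_le hR hΩ
  rw [integral_inner_sub_average h1.memV.memLp h2.memV.memLp,
    formB_self hΩ hΩb h0.memV hav.memV hav.cont] at eq
  simp_rw [mul_comm (p n _)] at eq
  rw [hdiv] at eq
  rw [vgradSq_add hΩ h1.memV h2.memV]
  set D := vgradSq Ω fun x => (2 : ℝ)⁻¹ • (u (n + 1) x + u (n - 1) x) with hD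
  have hD0 : 0 ≤ D := vgradSq_nonneg _
  set X := 2 * l2Sq Ω (f n) + 4 * g ^ 2 * (volume.real Ω + γ ^ 2 * l2Sq Ω (c n))
  have hP' : κ / (2 * (16 * R ^ 2 + 1)) *
      l2Sq Ω (fun x => (2 : ℝ)⁻¹ • (u (n + 1) x + u (n - 1) x)) ≤ κ / 2 * D := by
    calc _ ≤ κ / (2 * (16 * R ^ 2 + 1)) * ((16 * R ^ 2 + 1) * D) :=
          mul_le_mul_of_nonneg_left (by linarith) hδ.le
      _ = κ / 2 * D := by field_simp
  have step : (4 * τ)⁻¹ * (l2Sq Ω (u (n + 1)) - l2Sq Ω (u (n - 1))) + κ / 2 * D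
      ≤ (4 * (κ / (2 * (16 * R ^ 2 + 1))))⁻¹ * X := by linarith
  -- The factor `4` in `4 * τ` also turns `D` into the squared gradient norm of the sum.
  have step' := mul_le_mul_of_nonneg_left step (by positivity : 0 ≤ 4 * τ)
  have e1 : 4 * τ * ((4 * τ)⁻¹ * (l2Sq Ω (u (n + 1)) - l2Sq Ω (u (n - 1))) + κ / 2 * D)
      = l2Sq Ω (u (n + 1)) - l2Sq Ω (u (n - 1)) + κ / 2 * τ * (4 * D) := by
    field_simp
  have e2 : 4 * τ * ((4 * (κ / (2 * (16 * R ^ 2 + 1))))⁻¹ * X)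
      = 2 * (16 * R ^ 2 + 1) / κ * τ * X := by
    field_simp
  rwa [e1, e2] at step'

/-- Energy estimate of the concentration for one time step. -/
lemma IsCNLFSolution.concentration_step (hΩ : IsOpen Ω) (hΩb : Bornology.IsBounded Ω)
    (hsol : IsCNLFSolution Ω K e ν α g γ θ U τ N f u p c) (hθ : 0 < θ) (hτ : 0 < τ)
    {n : ℕ} (hn : 1 ≤ n) (hnN : n + 1 ≤ N) :
    l2Sq Ω (c (n + 1)) - l2Sq Ω (c (n - 1))
        + θ / 2 * τ * gradSq Ω (fun x => c (n + 1) x + c (n - 1) x)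
      ≤ 4 * U ^ 2 / θ * τ * (l2Sq Ω (c n) + α ^ 2 * volume.real Ω) := by
  have h1 := hsol.memc (n + 1) hnN
  have h2 := hsol.memc (n - 1) (by omega)
  have hc := (hsol.memc n (by omega)).memHt.1.1
  have hav := h1.average hΩb h2
  have eq := hsol.concentration n hn hnN _ hav
  have hS := swimming_le hΩb hc hav.memHt.1 e U α hθ
  have hG : ∫ x in Ω, ∑ j, wd Ω j (fun y => (c (n + 1) y + c (n - 1) y) / 2) x
      * wd Ω j (fun y => (c (n + 1) y + c (n - 1) y) / 2) x
      = gradSq Ω (fun y => (c (n + 1) y + c (n - 1) y) / 2) := by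
    simp_rw [← pow_two]
    rw [integral_finsetSum _ fun j _ => (memLp_wd hav.memHt.1 j).integrable_sq]
    rfl
  rw [integral_sub_mul_average h1.memHt.1.1 h2.memHt.1.1,
    formb_self hΩ hΩb (hsol.memu n (by omega)).memV hav.memHt.1 hav.cont, hG] at eq
  rw [gradSq_add hΩ h1.memHt.1 h2.memHt.1, ← average_eq]
  set D := gradSq Ω fun y => (c (n + 1) y + c (n - 1) y) / 2
  set X := l2Sq Ω (c n) + α ^ 2 * volume.real Ω
  have step : (4 * τ)⁻¹ * (l2Sq Ω (c (n + 1)) - l2Sq Ω (c (n - 1))) + θ / 2 * D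
      ≤ U ^ 2 / θ * X := by linarith
  have step' := mul_le_mul_of_nonneg_left step (by positivity : 0 ≤ 4 * τ)
  have e1 : 4 * τ * ((4 * τ)⁻¹ * (l2Sq Ω (c (n + 1)) - l2Sq Ω (c (n - 1))) + θ / 2 * D)
      = l2Sq Ω (c (n + 1)) - l2Sq Ω (c (n - 1)) + θ / 2 * τ * (4 * D) := by
    field_simp
  have e2 : 4 * τ * (U ^ 2 / θ * X) = 4 * U ^ 2 / θ * τ * X := by
    field_simp
  rwa [e1, e2] at step'

/-! ### Discrete Gronwall inequality -/

/-- An explicit discrete Gronwall inequality for a dissipative sequence. -/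
lemma discrete_gronwall {E Q F : ℕ → ℝ} {l : ℝ} (hl : 0 ≤ l) (hE : ∀ n, 0 ≤ E n)
    (hQ : ∀ n, 0 ≤ Q n) (hF : ∀ n, 0 ≤ F n) {M : ℕ}
    (step : ∀ n, 1 ≤ n → n ≤ M → E n + Q n ≤ E (n - 1) + l * (E (n - 1) + F n)) :
    ∀ m ≤ M, E m + ∑ n ∈ Finset.Icc 1 m, Q n
      ≤ Real.exp (m * l) * (E 0 + l * ∑ n ∈ Finset.Icc 1 m, F n) := by
  intro m
  induction m with
  | zero => simp
  | succ m ih =>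
    intro hm
    have h1 := ih (by omega)
    have h2 := step (m + 1) (by omega) hm
    rw [Nat.add_sub_cancel] at h2
    rw [Finset.sum_Icc_succ_top (by omega), Finset.sum_Icc_succ_top (by omega)]
    set SQ := ∑ n ∈ Finset.Icc 1 m, Q n
    set SF := ∑ n ∈ Finset.Icc 1 m, F n
    have hSQ : 0 ≤ SQ := Finset.sum_nonneg fun n _ => hQ n
    have hexp : Real.exp (m * l) * (1 + l) ≤ Real.exp (((m + 1 : ℕ) : ℝ) * l) := by
      rw [show (((m + 1 : ℕ) : ℝ) * l) = m * l + l by push_cast; ring, Real.exp_add]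
      exact mul_le_mul_of_nonneg_left (by linarith [Real.add_one_le_exp l]) (Real.exp_pos _).le
    have hexp1 : 1 ≤ Real.exp (((m + 1 : ℕ) : ℝ) * l) := Real.one_le_exp (by positivity)
    have hSF : 0 ≤ SF := Finset.sum_nonneg fun n _ => hF n
    have hA : 0 ≤ E 0 + l * SF := by have := hE 0; positivity
    -- The accumulated dissipation is carried along with `E`, using `SQ ≤ (1 + l) * SQ`.
    calc E (m + 1) + (SQ + Q (m + 1)) ≤ (1 + l) * (E m + SQ) + l * F (m + 1) := by
          nlinarith [mul_nonneg hl hSQ]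
      _ ≤ (1 + l) * (Real.exp (m * l) * (E 0 + l * SF)) + l * F (m + 1) := by gcongr
      _ = Real.exp (m * l) * (1 + l) * (E 0 + l * SF) + 1 * (l * F (m + 1)) := by ring
      _ ≤ Real.exp (((m + 1 : ℕ) : ℝ) * l) * (E 0 + l * SF)
          + Real.exp (((m + 1 : ℕ) : ℝ) * l) * (l * F (m + 1)) := by
          have := mul_nonneg hl (hF (m + 1))
          gcongr
      _ = _ := by ring

/-- The energy estimate of the scheme over the time steps `1, …, m`. -/
lemma IsCNLFSolution.energy_le (hΩ : IsOpen Ω) (hΩb : Bornology.IsBounded Ω)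
    (hsol : IsCNLFSolution Ω K e ν α g γ θ U τ N f u p c) (hν : ViscosityAssumption κ β ν)
    (hκ : 0 < κ) (hθ : 0 < θ) (hτ : 0 < τ) {R : ℝ} (hR : ∀ x ∈ Ω, ‖x‖ ≤ R)
    (hf : ∀ n ≤ N, MemL2 Ω (f n)) {L : ℝ}
    (hL : 2 * (16 * R ^ 2 + 1) / κ * (2 + 4 * g ^ 2 * (1 + γ ^ 2))
      + 4 * U ^ 2 / θ * (1 + α ^ 2) ≤ L) {m : ℕ} (hm : m ≤ N - 1) :
    (l2Sq Ω (u (m + 1)) + l2Sq Ω (u m) + l2Sq Ω (c (m + 1)) + l2Sq Ω (c m))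
      + ∑ n ∈ Finset.Icc 1 m, (κ / 2 * τ * vgradSq Ω (fun x => u (n + 1) x + u (n - 1) x)
        + θ / 2 * τ * gradSq Ω (fun x => c (n + 1) x + c (n - 1) x))
      ≤ Real.exp (m * (L * τ)) * ((l2Sq Ω (u 1) + l2Sq Ω (u 0) + l2Sq Ω (c 1) + l2Sq Ω (c 0))
        + L * τ * ∑ n ∈ Finset.Icc 1 m, (l2Sq Ω (f n) + volume.real Ω)) := by
  have hL0 : 0 ≤ L := le_trans (by positivity) hL
  -- One time step compares levels `n + 1` and `n - 1`; adding level `n` to both sides turns this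
  -- into a comparison of `E n` with `E (n - 1)`.
  refine discrete_gronwall
    (E := fun m => l2Sq Ω (u (m + 1)) + l2Sq Ω (u m) + l2Sq Ω (c (m + 1)) + l2Sq Ω (c m))
    (Q := fun n => κ / 2 * τ * vgradSq Ω (fun x => u (n + 1) x + u (n - 1) x)
        + θ / 2 * τ * gradSq Ω (fun x => c (n + 1) x + c (n - 1) x))
    (F := fun n => l2Sq Ω (f n) + volume.real Ω) (mul_nonneg hL0 hτ.le) (fun n => ?_)
    (fun n => ?_) (fun n => ?_) (M := N - 1) (fun n hn hnN => ?_) m hm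
  · linarith [l2Sq_nonneg (Ω := Ω) (u (n + 1)), l2Sq_nonneg (Ω := Ω) (u n),
      l2Sq_nonneg (Ω := Ω) (c (n + 1)), l2Sq_nonneg (Ω := Ω) (c n)]
  · have := vgradSq_nonneg (Ω := Ω) (fun x => u (n + 1) x + u (n - 1) x)
    have := gradSq_nonneg (Ω := Ω) (fun x => c (n + 1) x + c (n - 1) x)
    positivity
  · exact add_nonneg (l2Sq_nonneg _) measureReal_nonneg
  · have h1 := hsol.velocity_step hΩ hΩb hν hκ hτ hR hn (by omega) (hf n (by omega))
    have h2 := hsol.concentration_step hΩ hΩb hθ hτ hn (by omega)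
    simp only [Nat.sub_add_cancel hn]
    have n1 := l2Sq_nonneg (Ω := Ω) (u n)
    have n2 := l2Sq_nonneg (Ω := Ω) (u (n - 1))
    have n3 := l2Sq_nonneg (Ω := Ω) (c n)
    have n4 := l2Sq_nonneg (Ω := Ω) (c (n - 1))
    have n5 := l2Sq_nonneg (Ω := Ω) (f n)
    have n6 : 0 ≤ volume.real Ω := measureReal_nonneg
    set A := 2 * (16 * R ^ 2 + 1) / κ with hA
    set B := 4 * U ^ 2 / θ with hB
    have hA0 : 0 ≤ A := by positivity
    have hB0 : 0 ≤ B := by positivity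
    -- The only unknown in `S` is `c n`, already part of `E (n - 1)`. Hence the recursion is
    -- explicit and `τ` is unrestricted.
    set S := l2Sq Ω (c n) + l2Sq Ω (f n) + volume.real Ω with hS
    have b1 : 2 * l2Sq Ω (f n) + 4 * g ^ 2 * (volume.real Ω + γ ^ 2 * l2Sq Ω (c n))
        ≤ (2 + 4 * g ^ 2 * (1 + γ ^ 2)) * S := by
      have t : volume.real Ω + γ ^ 2 * l2Sq Ω (c n) ≤ (1 + γ ^ 2) * S := by
        rw [hS]
        nlinarith [mul_nonneg (sq_nonneg γ) n5, mul_nonneg (sq_nonneg γ) n6]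
      have := mul_le_mul_of_nonneg_left t (by positivity : 0 ≤ 4 * g ^ 2)
      linarith
    have b2 : l2Sq Ω (c n) + α ^ 2 * volume.real Ω ≤ (1 + α ^ 2) * S := by
      rw [hS]
      nlinarith [mul_nonneg (sq_nonneg α) n3, mul_nonneg (sq_nonneg α) n5]
    have c1 := mul_le_mul_of_nonneg_left b1 (mul_nonneg hA0 hτ.le)
    have c2 := mul_le_mul_of_nonneg_left b2 (mul_nonneg hB0 hτ.le)
    have c3 := mul_le_mul_of_nonneg_right hL (mul_nonneg hτ.le (by positivity : 0 ≤ S))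
    have c4 := mul_nonneg (mul_nonneg hL0 hτ.le) (by positivity : 0 ≤
      l2Sq Ω (u n) + l2Sq Ω (u (n - 1)) + l2Sq Ω (c (n - 1)))
    rw [hS] at c1 c2 c3
    linarith

end Bioconvection

end

/-! ### The stability estimate -/

theorem theorem3p1 (d : ℕ) (hd : d = 2 ∨ d = 3)
    (Ω : Set (Bioconvection.Eu d)) (hΩo : IsOpen Ω) (hΩc : IsConnected Ω)
    (hΩb : Bornology.IsBounded Ω)
    (T κ β θ U γ g α : ℝ) (hT : 0 < T) (hκ : 0 < κ) (hβ : 0 < β) (hθ : 0 < θ) (hU : 0 < U)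
    (hγ : 0 < γ) :
    ∃ C : ℝ, 0 < C ∧
      ∀ ν : ℝ → ℝ, Bioconvection.ViscosityAssumption κ β ν →
      ∀ f : ℝ → Bioconvection.Eu d → Bioconvection.Eu d,
        (∀ t ∈ Set.Icc 0 T, Bioconvection.MemL2 Ω (f t)) →
      ∀ K : Geometry.SimplicialComplex ℝ (Bioconvection.Eu d), Bioconvection.IsTriangulation Ω K →
      ∀ (N : ℕ) (τ : ℝ), 1 ≤ N → τ = T / N →
      ∀ (u : ℕ → Bioconvection.Eu d → Bioconvection.Eu d) (p c : ℕ → Bioconvection.Eu d → ℝ),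
        Bioconvection.IsCNLFSolution Ω K ⟨1, by omega⟩ ν α g γ θ U τ N
          (fun n => f (n * τ)) u p c →
      ∀ m : ℕ, 1 ≤ m → m ≤ N - 1 →
        Bioconvection.l2Sq Ω (u (m + 1)) + Bioconvection.l2Sq Ω (c (m + 1))
          + κ * τ * ∑ n ∈ Finset.Icc 1 (N - 1),
              Bioconvection.vgradSq Ω (fun x => u (n + 1) x + u (n - 1) x)
          + θ * τ * ∑ n ∈ Finset.Icc 1 (N - 1),
              Bioconvection.gradSq Ω (fun x => c (n + 1) x + c (n - 1) x)
        ≤ C * (Bioconvection.l2Sq Ω (u 0) + Bioconvection.l2Sq Ω (u 1)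
              + Bioconvection.l2Sq Ω (c 0) + Bioconvection.l2Sq Ω (c 1))
          + C * τ * ∑ n ∈ Finset.Icc 1 (N - 1),
              (Bioconvection.l2Sq Ω (f (n * τ)) + volume.real Ω) := by
  obtain ⟨R, hR⟩ := hΩb.exists_norm_le
  set L := 2 * (16 * R ^ 2 + 1) / κ * (2 + 4 * g ^ 2 * (1 + γ ^ 2))
    + 4 * U ^ 2 / θ * (1 + α ^ 2) with hL
  have hL0 : 0 ≤ L := by positivity
  -- The energy bound is used once for the norms at level `m + 1` and, doubled because it carries `κ
  -- / 2` and `θ / 2`, for the dissipation: hence 3. The factor `1 + L` comes from `E0 + L * τ * SF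
  -- ≤ (1 + L) * (E0 + τ * SF)`.
  refine ⟨3 * Real.exp (L * T) * (1 + L), by positivity, ?_⟩
  intro ν hν f hf K _ N τ hN hτ u p c hsol m _ hmN
  have hN0 : (0 : ℝ) < N := by exact_mod_cast hN
  have hτ0 : 0 < τ := by rw [hτ]; positivity
  have hNτ : N * τ = T := by rw [hτ]; field_simp
  have hfn : ∀ n ≤ N, Bioconvection.MemL2 Ω (f (n * τ)) := fun n hn => by
    refine hf _ ⟨by positivity, ?_⟩
    rw [← hNτ]
    exact mul_le_mul_of_nonneg_right (by exact_mod_cast hn) hτ0.le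
  have energy := fun {k : ℕ} (hk : k ≤ N - 1) =>
    hsol.energy_le hΩo hΩb hν hκ hθ hτ0 hR hfn hL.ge hk
  have hexp : ∀ k ≤ N - 1, Real.exp (k * (L * τ)) ≤ Real.exp (L * T) := fun k hk => by
    rw [Real.exp_le_exp, ← hNτ]
    have hkN : (k : ℝ) ≤ N := by exact_mod_cast (by omega : k ≤ N)
    calc (k : ℝ) * (L * τ) ≤ N * (L * τ) := mul_le_mul_of_nonneg_right hkN (by positivity)
      _ = L * (N * τ) := by ring
  have hF : ∀ n : ℕ, 0 ≤ Bioconvection.l2Sq Ω (f (n * τ)) + volume.real Ω := fun n =>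
    add_nonneg (Bioconvection.l2Sq_nonneg _) measureReal_nonneg
  have hSF : ∑ n ∈ Finset.Icc 1 m, (Bioconvection.l2Sq Ω (f (n * τ)) + volume.real Ω)
      ≤ ∑ n ∈ Finset.Icc 1 (N - 1), (Bioconvection.l2Sq Ω (f (n * τ)) + volume.real Ω) :=
    Finset.sum_le_sum_of_subset_of_nonneg (Finset.Icc_subset_Icc_right hmN) fun n _ _ => hF n
  -- The dissipation sums run up to `N - 1` whatever `m` is, so the energy bound is needed at both
  -- indices.
  have e1 := energy hmN
  have e2 := energy le_rfl
  have sum_nonneg : ∀ k : ℕ, 0 ≤ ∑ n ∈ Finset.Icc 1 k,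
      (κ / 2 * τ * Bioconvection.vgradSq Ω (fun x => u (n + 1) x + u (n - 1) x)
        + θ / 2 * τ * Bioconvection.gradSq Ω (fun x => c (n + 1) x + c (n - 1) x)) := fun k =>
    Finset.sum_nonneg fun n _ => by
      have := Bioconvection.vgradSq_nonneg (Ω := Ω) (fun x => u (n + 1) x + u (n - 1) x)
      have := Bioconvection.gradSq_nonneg (Ω := Ω) (fun x => c (n + 1) x + c (n - 1) x)
      positivity
  have q1 := sum_nonneg m
  rw [Finset.sum_add_distrib, ← Finset.mul_sum, ← Finset.mul_sum] at e2
  set SF := ∑ n ∈ Finset.Icc 1 (N - 1), (Bioconvection.l2Sq Ω (f (n * τ)) + volume.real Ω)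
  set E0 := Bioconvection.l2Sq Ω (u 1) + Bioconvection.l2Sq Ω (u 0) + Bioconvection.l2Sq Ω (c 1)
    + Bioconvection.l2Sq Ω (c 0) with hE0
  have nn : ∀ k, 0 ≤ Bioconvection.l2Sq Ω (u k) := fun k => Bioconvection.l2Sq_nonneg _
  have nc : ∀ k, 0 ≤ Bioconvection.l2Sq Ω (c k) := fun k => Bioconvection.l2Sq_nonneg _
  have hE0' : 0 ≤ E0 := by linarith [nn 0, nn 1, nc 0, nc 1]
  have hSF0 : 0 ≤ SF := Finset.sum_nonneg fun n _ => hF n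
  have hX : 0 ≤ E0 + L * τ * SF := by positivity
  have b1 : Real.exp (m * (L * τ)) * (E0 + L * τ *
      ∑ n ∈ Finset.Icc 1 m, (Bioconvection.l2Sq Ω (f (n * τ)) + volume.real Ω))
      ≤ Real.exp (L * T) * (E0 + L * τ * SF) :=
    (mul_le_mul_of_nonneg_left (by gcongr) (Real.exp_pos _).le).trans
      (mul_le_mul_of_nonneg_right (hexp m hmN) hX)
  have b2 : Real.exp ((N - 1 : ℕ) * (L * τ)) * (E0 + L * τ * SF)
      ≤ Real.exp (L * T) * (E0 + L * τ * SF) :=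
    mul_le_mul_of_nonneg_right (hexp _ le_rfl) hX
  have b3 : E0 + L * τ * SF ≤ (1 + L) * (E0 + τ * SF) := by
    nlinarith [mul_nonneg hL0 hE0', mul_nonneg hτ0.le hSF0]
  have b4 := mul_le_mul_of_nonneg_left b3 (Real.exp_pos (L * T)).le
  have e0 : Bioconvection.l2Sq Ω (u 0) + Bioconvection.l2Sq Ω (u 1)
      + Bioconvection.l2Sq Ω (c 0) + Bioconvection.l2Sq Ω (c 1) = E0 := by
    rw [hE0]
    ring
  rw [e0]
  have e3 := nn m
  have e4 := nc m
  have e5 := nn (N - 1 + 1)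
  have e6 := nn (N - 1)
  have e7 := nc (N - 1 + 1)
  have e8 := nc (N - 1)
  linarith
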